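/- A fuzzy number is a function $u:\mathbb{R}\to[0,1]$ that is normal ($u(t)=1$ for some $t$), fuzzy convex ($u(\lambda s+(1-\lambda)t)\ge\min(u(s),u(t))$ for $\lambda\in[0,1]$), upper semicontinuous, and has compact support $\overline{\{t:u(t)>0\}}$. Its level sets $[u]_\alpha=\{t:u(t)\ge\alpha\}$ for $0<\alpha\le1$ and $[u]_0=\overline{\{t:u(t)>0\}}$ are compact intervals $[u^-_\alpha,u^+_\alpha]$. Addition and multiplication by real scalars are defined by $[u+v]_\alpha=[u]_\alpha+[v]_\alpha$ and $[ku]_\alpha=k[u]_\alpha$, and the set $\mathbb{R}_{\mathcal F}$ of fuzzy numbers carries the metric $D(u,v)=\sup_{\alpha\in[0,1]}\max\{|u^-_\alpha-v^-_\alpha|,|u^+_\alpha-v^+_\alpha|\}$. Let $C_{2\pi}^{(\mathcal F)}(\mathbb{R}^2)$ be the set of all $D$-continuous functions $f:\mathbb{R}^2\to\mathbb{R}_{\mathcal F}$ that are $2\pi$-periodic in each variable. For $f\in C_{2\pi}^{(\mathcal F)}(\mathbb{R}^2)$ and $0\le r<1$, $0\le s<1$ let $$P_{rs}(f;x,y)=\frac1{4\pi^2}\int_{-\pi}^{\pi}\int_{-\pi}^{\pi}f(x-u,y-v)\,\psi_r(u)\psi_s(v)\,du\,dv,\qquad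 \psi_r(x)=\frac{1-r^2}{1-2r\cos x+r^2},$$ where the integral is the fuzzy Riemann integral, i.e. the limit in the metric $D$ of the Riemann sums over tagged grids as the mesh tends to $0$. Theorem. Let $f\in C_{2\pi}^{(\mathcal F)}(\mathbb{R}^2)$. (1) For all $r,s\in[0,1)$ the integral defining $P_{rs}(f;x,y)$ exists for every $(x,y)\in\mathbb{R}^2$, and $P_{rs}(f)\in C_{2\pi}^{(\mathcal F)}(\mathbb{R}^2)$. Moreover $P_{rs}(f)$ is given by the Abel means of the double level Fourier series of $f$: for all $(x,y)$ and all $\alpha\in[0,1]$, $$\{P_{rs}(f;x,y)\}^{\mp}_\alpha=\sum_{j=0}^\infty\sum_{k=0}^\infty u^{\mp}_{jk}(\alpha;x,y)\,r^js^k$$ with unconditional (absolute) convergence and the convention $0^0=1$. Here $u^\mp_{00}=\frac{a^\mp_{00}}4$, $u^\mp_{j0}=\frac12(a^\mp_{j0}\cos jx+c^\mp_{j0}\sin jx)$ and $u^\mp_{0k}=\frac12(a^\mp_{0k}\cos ky+b^\mp_{0k}\sin ky)$ for $j,k\ge1$, and $$u^\mp_{jk}=a^\mp_{jk}\cos jx\cos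 ky+b^\mp_{jk}\cos jx\sin ky+c^\mp_{jk}\sin jx\cos ky+d^\mp_{jk}\sin jx\sin ky$$ for $j,k\ge1$, where $a^\mp_{jk},b^\mp_{jk},c^\mp_{jk},d^\mp_{jk}$ (depending on $\alpha$) are $\frac1{\pi^2}\int_{-\pi}^{\pi}\int_{-\pi}^{\pi}f^\mp_\alpha(x,y)\,h(x,y)\,dx\,dy$ with $h=\cos jx\cos ky$, $\cos jx\sin ky$, $\sin jx\cos ky$, $\sin jx\sin ky$ respectively. (2) $P_{rs}(f)\to f$ uniformly on $\mathbb{R}^2$ as $r,s\to1^-$: for every $\varepsilon>0$ there is $\eta>0$ such that $D(P_{rs}(f;x,y),f(x,y))<\varepsilon$ for all $r,s\in(1-\eta,1)$ and all $(x,y)\in\mathbb{R}^2$. -/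

import Mathlib

open Set Filter Topology MeasureTheory
open scoped Pointwise

/-- A fuzzy number: a fuzzy set `u : ℝ → [0, 1]` on the real line which is normal, fuzzy convex
(`u (λ s + (1 - λ) t) ≥ min (u s) (u t)`, i.e. quasiconcave), upper semicontinuous, and has
compact support. -/
@[ext]
structure FuzzyNumber where
  toFun : ℝ → ℝ
  nonneg : ∀ t, 0 ≤ toFun t
  le_one : ∀ t, toFun t ≤ 1
  normal : ∃ t, toFun t = 1
  fuzzyConvex : QuasiconcaveOn ℝ univ toFun
  usc : UpperSemicontinuous toFun
  compactSupp : IsCompact (closure {t | 0 < toFun t})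

namespace FuzzyNumber

/-- The level set `[u]_α`. Only `α ∈ [0, 1]` matters. -/
def level (u : FuzzyNumber) (α : ℝ) : Set ℝ :=
  if α = 0 then closure {t | 0 < u.toFun t} else {t | α ≤ u.toFun t}

/-- The left endpoint `u^-_α` of `[u]_α`. -/
noncomputable def lower (u : FuzzyNumber) (α : ℝ) : ℝ := sInf (u.level α)

/-- The right endpoint `u^+_α` of `[u]_α`. -/
noncomputable def upper (u : FuzzyNumber) (α : ℝ) : ℝ := sSup (u.level α)

theorem level_zero (u : FuzzyNumber) : u.level 0 = closure {t | 0 < u.toFun t} := by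
  simp [level]

theorem level_pos (u : FuzzyNumber) {α : ℝ} (h : 0 < α) :
    u.level α = {t | α ≤ u.toFun t} := by
  simp [level, h.ne']

theorem isClosed_level (u : FuzzyNumber) {α : ℝ} (h : 0 ≤ α) : IsClosed (u.level α) := by
  rcases h.eq_or_lt with rfl | h
  · rw [level_zero]; exact isClosed_closure
  · rw [level_pos u h]
    exact upperSemicontinuous_iff_isClosed_preimage.1 u.usc α

theorem level_anti (u : FuzzyNumber) {α β : ℝ} (h : 0 ≤ α) (hab : α ≤ β) :
    u.level β ⊆ u.level α := by
  rcases h.eq_or_lt with rfl | h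
  · rcases hab.eq_or_lt with rfl | hb
    · exact subset_rfl
    · rw [level_zero, level_pos u hb]
      exact fun t ht => subset_closure (lt_of_lt_of_le hb ht)
  · rw [level_pos u h, level_pos u (h.trans_le hab)]
    exact fun t ht => le_trans hab ht

theorem isCompact_level (u : FuzzyNumber) {α : ℝ} (h : 0 ≤ α) : IsCompact (u.level α) := by
  refine IsCompact.of_isClosed_subset ?_ (u.isClosed_level h) (u.level_anti le_rfl h)
  rw [level_zero]; exact u.compactSupp

theorem nonempty_level (u : FuzzyNumber) {α : ℝ} (h : 0 ≤ α) (h1 : α ≤ 1) :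
    (u.level α).Nonempty := by
  obtain ⟨t, ht⟩ := u.normal
  refine ⟨t, u.level_anti h h1 ?_⟩
  rw [level_pos u one_pos]
  exact ht.ge

theorem convex_level (u : FuzzyNumber) {α : ℝ} (h : 0 ≤ α) : Convex ℝ (u.level α) := by
  rcases h.eq_or_lt with rfl | h
  · rw [level_zero]
    refine Convex.closure ?_
    simpa using u.fuzzyConvex.convex_gt 0
  · rw [level_pos u h]
    simpa using u.fuzzyConvex α

theorem level_eq_Icc (u : FuzzyNumber) {α : ℝ} (h : 0 ≤ α) (h1 : α ≤ 1) :
    u.level α = Icc (u.lower α) (u.upper α) :=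
  eq_Icc_of_connected_compact
    ⟨u.nonempty_level h h1, (u.convex_level h).isPreconnected⟩ (u.isCompact_level h)

theorem ext_level {u v : FuzzyNumber} (h : ∀ α, 0 < α → α ≤ 1 → u.level α = v.level α) :
    u = v := by
  have key : ∀ u v : FuzzyNumber, (∀ α, 0 < α → α ≤ 1 → u.level α = v.level α) →
      ∀ t, u.toFun t ≤ v.toFun t := by
    intro u v h t
    rcases (u.nonneg t).eq_or_lt with h0 | h0
    · rw [← h0]; exact v.nonneg t
    · have := h _ h0 (u.le_one t)
      rw [level_pos u h0, level_pos v h0] at this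
      have ht : t ∈ {s | u.toFun t ≤ u.toFun s} := le_refl (u.toFun t)
      rw [this] at ht
      exact ht
  ext t
  exact le_antisymm (key u v h t) (key v u (fun α h0 h1 => (h α h0 h1).symm) t)

/-- The membership function with prescribed level sets `K α`, `0 < α ≤ 1`. -/
noncomputable def ofLevelsFun (K : ℝ → Set ℝ) (t : ℝ) : ℝ :=
  sSup {α | α = 0 ∨ (0 < α ∧ α ≤ 1 ∧ t ∈ K α)}

section ofLevels

variable {K : ℝ → Set ℝ}

theorem bddAbove_ofLevelsSet (K : ℝ → Set ℝ) (t : ℝ) :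
    BddAbove {α | α = 0 ∨ (0 < α ∧ α ≤ 1 ∧ t ∈ K α)} := by
  refine ⟨1, ?_⟩
  rintro α (rfl | ⟨_, h, _⟩)
  · exact zero_le_one
  · exact h

theorem ofLevelsFun_nonneg (K : ℝ → Set ℝ) (t : ℝ) : 0 ≤ ofLevelsFun K t :=
  le_csSup (bddAbove_ofLevelsSet K t) (Or.inl rfl)

theorem ofLevelsFun_le_one (K : ℝ → Set ℝ) (t : ℝ) : ofLevelsFun K t ≤ 1 := by
  refine csSup_le ⟨0, Or.inl rfl⟩ ?_
  rintro α (rfl | ⟨_, h, _⟩)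
  · exact zero_le_one
  · exact h

theorem le_ofLevelsFun_iff
    (anti : ∀ α β, 0 < α → α ≤ β → β ≤ 1 → K β ⊆ K α)
    (left : ∀ α, 0 < α → α ≤ 1 → ∀ t, (∀ β, 0 < β → β < α → t ∈ K β) → t ∈ K α)
    {α : ℝ} (h0 : 0 < α) (h1 : α ≤ 1) (t : ℝ) : α ≤ ofLevelsFun K t ↔ t ∈ K α := by
  constructor
  · intro h
    refine left α h0 h1 t fun β hβ hβα => ?_
    obtain ⟨γ, hγ, hlt⟩ := exists_lt_of_lt_csSup (⟨0, Or.inl rfl⟩ :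
      {α | α = 0 ∨ (0 < α ∧ α ≤ 1 ∧ t ∈ K α)}.Nonempty) (lt_of_lt_of_le hβα h)
    rcases hγ with rfl | ⟨_, hγ1, hγt⟩
    · exact absurd hlt (not_lt.2 hβ.le)
    · exact anti β γ hβ hlt.le hγ1 hγt
  · intro h
    exact le_csSup (bddAbove_ofLevelsSet K t) (Or.inr ⟨h0, h1, h⟩)

/-- The fuzzy number whose level sets are the given compact intervals `K α`, `0 < α ≤ 1`
(decreasing and left continuous in `α`, inside a fixed compact set). -/
noncomputable def ofLevels (K : ℝ → Set ℝ)
    (ne : (K 1).Nonempty)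
    (closed : ∀ α, 0 < α → α ≤ 1 → IsClosed (K α))
    (convex : ∀ α, 0 < α → α ≤ 1 → Convex ℝ (K α))
    (anti : ∀ α β, 0 < α → α ≤ β → β ≤ 1 → K β ⊆ K α)
    (left : ∀ α, 0 < α → α ≤ 1 → ∀ t, (∀ β, 0 < β → β < α → t ∈ K β) → t ∈ K α)
    (bdd : ∃ B, IsCompact B ∧ ∀ α, 0 < α → α ≤ 1 → K α ⊆ B) : FuzzyNumber where
  toFun := ofLevelsFun K
  nonneg := ofLevelsFun_nonneg K
  le_one := ofLevelsFun_le_one K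
  normal := by
    obtain ⟨t, ht⟩ := ne
    exact ⟨t, le_antisymm (ofLevelsFun_le_one K t)
      ((le_ofLevelsFun_iff anti left one_pos le_rfl t).2 ht)⟩
  fuzzyConvex := by
    intro r
    by_cases h0 : 0 < r
    · by_cases h1 : r ≤ 1
      · simpa [le_ofLevelsFun_iff anti left h0 h1] using convex r h0 h1
      · have : {x | x ∈ univ ∧ r ≤ ofLevelsFun K x} = ∅ := by
          ext x
          simpa using lt_of_le_of_lt (ofLevelsFun_le_one K x) (not_le.1 h1)
        rw [this]; exact convex_empty
    · have : {x | x ∈ univ ∧ r ≤ ofLevelsFun K x} = univ := by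
        ext x
        simpa using le_trans (not_lt.1 h0) (ofLevelsFun_nonneg K x)
      rw [this]; exact convex_univ
  usc := by
    rw [upperSemicontinuous_iff_isClosed_preimage]
    intro r
    by_cases h0 : 0 < r
    · by_cases h1 : r ≤ 1
      · have : ofLevelsFun K ⁻¹' Ici r = K r := by
          ext x; exact le_ofLevelsFun_iff anti left h0 h1 x
        rw [this]; exact closed r h0 h1
      · have : ofLevelsFun K ⁻¹' Ici r = ∅ := by
          ext x
          simpa using lt_of_le_of_lt (ofLevelsFun_le_one K x) (not_le.1 h1)
        rw [this]; exact isClosed_empty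
    · have : ofLevelsFun K ⁻¹' Ici r = univ := by
        ext x
        simpa using le_trans (not_lt.1 h0) (ofLevelsFun_nonneg K x)
      rw [this]; exact isClosed_univ
  compactSupp := by
    obtain ⟨B, hB, hKB⟩ := bdd
    refine hB.of_isClosed_subset isClosed_closure (closure_minimal ?_ hB.isClosed)
    intro t ht
    exact hKB _ ht (ofLevelsFun_le_one K t)
      ((le_ofLevelsFun_iff anti left ht (ofLevelsFun_le_one K t) t).1 le_rfl)

end ofLevels

theorem mem_level_of_forall_lt (w : FuzzyNumber) {α x : ℝ} (h0 : 0 < α)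
    (hx : ∀ β ∈ Ioo 0 α, x ∈ w.level β) : x ∈ w.level α := by
  rw [level_pos w h0]
  change α ≤ w.toFun x
  refine le_of_forall_lt_imp_le_of_dense fun β hβ => ?_
  rcases le_or_gt β 0 with hb | hb
  · exact hb.trans (w.nonneg x)
  · have := hx β ⟨hb, hβ⟩
    rwa [level_pos w hb] at this

theorem mem_image_level (g : ℝ × ℝ →L[ℝ] ℝ) (u v : FuzzyNumber) {α : ℝ} (h0 : 0 ≤ α) (t : ℝ)
    (D : Set ℝ) (hD : ∀ β ∈ D, 0 ≤ β) (hne : D.Nonempty)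
    (hint : ∀ w : FuzzyNumber, ∀ x, (∀ β ∈ D, x ∈ w.level β) → x ∈ w.level α)
    (h : ∀ β ∈ D, t ∈ g '' (u.level β ×ˢ v.level β)) :
    t ∈ g '' (u.level α ×ˢ v.level α) := by
  have : Nonempty D := hne.to_subtype
  obtain ⟨p, hp⟩ := IsCompact.nonempty_iInter_of_directed_nonempty_isCompact_isClosed
    (fun β : D => (u.level β ×ˢ v.level β) ∩ g ⁻¹' {t})
    (by
      intro β γ
      rcases le_total (β : ℝ) γ with hle | hle
      · refine ⟨γ, ?_, subset_rfl⟩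
        exact inter_subset_inter_left _
          (prod_mono (u.level_anti (hD _ β.2) hle) (v.level_anti (hD _ β.2) hle))
      · refine ⟨β, subset_rfl, ?_⟩
        exact inter_subset_inter_left _
          (prod_mono (u.level_anti (hD _ γ.2) hle) (v.level_anti (hD _ γ.2) hle)))
    (by
      rintro ⟨β, hβ⟩
      obtain ⟨p, hp, hpt⟩ := h β hβ
      exact ⟨p, hp, hpt⟩)
    (fun β => ((u.isCompact_level (hD _ β.2)).prod (v.isCompact_level (hD _ β.2))).inter_right
      (isClosed_singleton.preimage g.continuous))
    (fun β => ((u.isClosed_level (hD _ β.2)).prod (v.isClosed_level (hD _ β.2))).inter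
      (isClosed_singleton.preimage g.continuous))
  rw [mem_iInter] at hp
  refine ⟨p, ⟨hint u _ fun β hβ => (hp ⟨β, hβ⟩).1.1, hint v _ fun β hβ => (hp ⟨β, hβ⟩).1.2⟩, ?_⟩
  obtain ⟨β, hβ⟩ := hne
  exact (hp ⟨β, hβ⟩).2

/-- The image of two fuzzy numbers under a linear map `g : ℝ² → ℝ`, level set by level set:
`[map₂ g u v]_α = g ([u]_α × [v]_α)`. -/
noncomputable def map₂ (g : ℝ × ℝ →L[ℝ] ℝ) (u v : FuzzyNumber) : FuzzyNumber :=
  ofLevels (fun α => g '' (u.level α ×ˢ v.level α))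
    (((u.nonempty_level zero_le_one le_rfl).prod (v.nonempty_level zero_le_one le_rfl)).image _)
    (fun _ h0 _ => (((u.isCompact_level h0.le).prod (v.isCompact_level h0.le)).image
      g.continuous).isClosed)
    (fun _ h0 _ => ((u.convex_level h0.le).prod (v.convex_level h0.le)).linear_image
      g.toLinearMap)
    (fun _ _ h0 hab _ => image_mono
      (prod_mono (u.level_anti h0.le hab) (v.level_anti h0.le hab)))
    (fun α h0 _ t ht => mem_image_level g u v h0.le t (Ioo 0 α) (fun _ hβ => hβ.1.le)
      (nonempty_Ioo.2 h0)
      (fun w _ hx => w.mem_level_of_forall_lt h0 hx)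
      fun β hβ => ht β hβ.1 hβ.2)
    ⟨g '' (u.level 0 ×ˢ v.level 0),
      ((u.isCompact_level le_rfl).prod (v.isCompact_level le_rfl)).image g.continuous,
      fun _ h0 _ => image_mono
        (prod_mono (u.level_anti le_rfl h0.le) (v.level_anti le_rfl h0.le))⟩

theorem level_map₂_pos (g : ℝ × ℝ →L[ℝ] ℝ) (u v : FuzzyNumber) {α : ℝ} (h0 : 0 < α)
    (h1 : α ≤ 1) : (map₂ g u v).level α = g '' (u.level α ×ˢ v.level α) := by
  rw [level_pos _ h0]
  ext t
  refine le_ofLevelsFun_iff (K := fun α => g '' (u.level α ×ˢ v.level α)) ?_ ?_ h0 h1 t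
  · exact fun _ _ h0 hab _ => image_mono
      (prod_mono (u.level_anti h0.le hab) (v.level_anti h0.le hab))
  · exact fun α h0 _ t ht => mem_image_level g u v h0.le t (Ioo 0 α) (fun _ hβ => hβ.1.le)
      (nonempty_Ioo.2 h0)
      (fun w _ hx => w.mem_level_of_forall_lt h0 hx)
      fun β hβ => ht β hβ.1 hβ.2

theorem level_map₂ (g : ℝ × ℝ →L[ℝ] ℝ) (u v : FuzzyNumber) {α : ℝ} (h0 : 0 ≤ α)
    (h1 : α ≤ 1) : (map₂ g u v).level α = g '' (u.level α ×ˢ v.level α) := by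
  rcases h0.eq_or_lt with rfl | h0
  · apply subset_antisymm
    · rw [level_zero]
      refine closure_minimal (fun t ht => ?_) (((u.isCompact_level le_rfl).prod
        (v.isCompact_level le_rfl)).image g.continuous).isClosed
      have hl := level_map₂_pos g u v ht ((map₂ g u v).le_one t)
      have hm : t ∈ (map₂ g u v).level ((map₂ g u v).toFun t) := by
        rw [level_pos _ ht]; exact le_refl ((map₂ g u v).toFun t)
      rw [hl] at hm
      exact image_mono (prod_mono (u.level_anti le_rfl (le_of_lt ht))
        (v.level_anti le_rfl (le_of_lt ht))) hm
    · rw [level_zero u, level_zero v, ← closure_prod_eq]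
      refine (image_closure_subset_closure_image g.continuous).trans ?_
      rw [level_zero]
      refine closure_mono ?_
      rintro _ ⟨⟨x, y⟩, ⟨hx, hy⟩, rfl⟩
      have hx : 0 < u.toFun x := hx
      have hy : 0 < v.toFun y := hy
      have hm : 0 < min (u.toFun x) (v.toFun y) := lt_min hx hy
      have hl := level_map₂_pos g u v hm ((min_le_left _ _).trans (u.le_one x))
      have : g (x, y) ∈ (map₂ g u v).level (min (u.toFun x) (v.toFun y)) := by
        rw [hl]
        refine mem_image_of_mem _ ⟨?_, ?_⟩
        · rw [level_pos u hm]; exact min_le_left (u.toFun x) (v.toFun y)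
        · rw [level_pos v hm]; exact min_le_right (u.toFun x) (v.toFun y)
      rw [level_pos _ hm] at this
      exact hm.trans_le this
  · exact level_map₂_pos g u v h0 h1

/-- The crisp number `r`, as a fuzzy number. -/
noncomputable def crisp (r : ℝ) : FuzzyNumber where
  toFun := ({r} : Set ℝ).indicator 1
  nonneg t := indicator_nonneg (fun _ _ => zero_le_one) t
  le_one t := indicator_le_self' (fun _ _ => zero_le_one) t
  normal := ⟨r, by simp⟩
  fuzzyConvex := by
    intro c
    by_cases h0 : c ≤ 0
    · have : {x | x ∈ univ ∧ c ≤ ({r} : Set ℝ).indicator (1 : ℝ → ℝ) x} = univ := by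
        ext x
        simpa only [mem_ofPred_eq, mem_univ, true_and, iff_true] using h0.trans (indicator_nonneg (f := (1 : ℝ → ℝ)) (fun _ _ => zero_le_one) x)
      rw [this]; exact convex_univ
    · refine Set.Subsingleton.convex ?_
      intro x hx y hy
      have aux : ∀ z, c ≤ ({r} : Set ℝ).indicator (1 : ℝ → ℝ) z → z = r := by
        intro z hz
        by_contra hne
        rw [indicator_of_notMem (by simpa using hne)] at hz
        exact h0 hz
      rw [aux x hx.2, aux y hy.2]
  usc := isClosed_singleton.upperSemicontinuous_indicator zero_le_one
  compactSupp := by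
    refine isCompact_singleton.of_isClosed_subset (s := {r}) isClosed_closure
      (closure_minimal (fun t ht => ?_) isClosed_singleton)
    by_contra hne
    have ht : 0 < ({r} : Set ℝ).indicator (1 : ℝ → ℝ) t := ht
    rw [indicator_of_notMem hne] at ht
    exact lt_irrefl _ ht

noncomputable instance : Zero FuzzyNumber := ⟨crisp 0⟩

noncomputable instance : Add FuzzyNumber :=
  ⟨map₂ (ContinuousLinearMap.fst ℝ ℝ ℝ + ContinuousLinearMap.snd ℝ ℝ ℝ)⟩

noncomputable instance : SMul ℝ FuzzyNumber :=
  ⟨fun k u => map₂ (k • ContinuousLinearMap.fst ℝ ℝ ℝ) u u⟩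

theorem level_add (u v : FuzzyNumber) {α : ℝ} (h0 : 0 ≤ α) (h1 : α ≤ 1) :
    (u + v).level α = u.level α + v.level α := by
  refine (level_map₂ _ u v h0 h1).trans ?_
  exact add_image_prod

theorem level_smul (k : ℝ) (u : FuzzyNumber) {α : ℝ} (h0 : 0 ≤ α) (h1 : α ≤ 1) :
    (k • u).level α = k • u.level α := by
  refine (level_map₂ _ u u h0 h1).trans ?_
  ext t
  constructor
  · rintro ⟨⟨x, y⟩, ⟨hx, _⟩, rfl⟩
    exact ⟨x, hx, rfl⟩
  · rintro ⟨x, hx, rfl⟩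
    exact ⟨(x, x), ⟨hx, hx⟩, rfl⟩

theorem level_zero_number {α : ℝ} (h0 : 0 < α) (h1 : α ≤ 1) :
    (0 : FuzzyNumber).level α = {0} := by
  rw [level_pos _ h0]
  ext t
  change α ≤ ({0} : Set ℝ).indicator (1 : ℝ → ℝ) t ↔ t = 0
  by_cases h : t = 0
  · simp [h, h1]
  · simp [h, h0]

noncomputable instance : AddCommMonoid FuzzyNumber where
  add_assoc u v w := ext_level fun α h0 h1 => by
    simp only [level_add _ _ h0.le h1, add_assoc]
  zero_add u := ext_level fun α h0 h1 => by
    simp [level_add _ _ h0.le h1, level_zero_number h0 h1]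
  add_zero u := ext_level fun α h0 h1 => by
    simp [level_add _ _ h0.le h1, level_zero_number h0 h1]
  add_comm u v := ext_level fun α h0 h1 => by
    simp only [level_add _ _ h0.le h1, add_comm]
  nsmul := nsmulRec

/-- The supremum metric `D(u, v) = sup_{α ∈ [0, 1]} max(|u^-_α - v^-_α|, |u^+_α - v^+_α|)`. -/
noncomputable instance : Dist FuzzyNumber :=
  ⟨fun u v => ⨆ α : Icc (0 : ℝ) 1,
    max |u.lower α - v.lower α| |u.upper α - v.upper α|⟩

theorem dist_def (u v : FuzzyNumber) : dist u v = ⨆ α : Icc (0 : ℝ) 1,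
    max |u.lower α - v.lower α| |u.upper α - v.upper α| := rfl

theorem lower_mem (u : FuzzyNumber) {α : ℝ} (h0 : 0 ≤ α) (h1 : α ≤ 1) :
    u.lower α ∈ u.level α :=
  (u.isCompact_level h0).sInf_mem (u.nonempty_level h0 h1)

theorem upper_mem (u : FuzzyNumber) {α : ℝ} (h0 : 0 ≤ α) (h1 : α ≤ 1) :
    u.upper α ∈ u.level α :=
  (u.isCompact_level h0).sSup_mem (u.nonempty_level h0 h1)

theorem bddAbove_dist (u v : FuzzyNumber) : BddAbove (range fun α : Icc (0 : ℝ) 1 =>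
    max |u.lower α - v.lower α| |u.upper α - v.upper α|) := by
  obtain ⟨A, hA⟩ := (u.isCompact_level le_rfl).isBounded.exists_norm_le
  obtain ⟨B, hB⟩ := (v.isCompact_level le_rfl).isBounded.exists_norm_le
  refine ⟨A + B, ?_⟩
  rintro _ ⟨⟨α, h0, h1⟩, rfl⟩
  refine max_le ?_ ?_
  · exact (norm_sub_le _ _).trans (add_le_add (hA _ (u.level_anti le_rfl h0 (u.lower_mem h0 h1)))
      (hB _ (v.level_anti le_rfl h0 (v.lower_mem h0 h1))))
  · exact (norm_sub_le _ _).trans (add_le_add (hA _ (u.level_anti le_rfl h0 (u.upper_mem h0 h1)))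
      (hB _ (v.level_anti le_rfl h0 (v.upper_mem h0 h1))))

theorem le_dist (u v : FuzzyNumber) (α : Icc (0 : ℝ) 1) :
    max |u.lower α - v.lower α| |u.upper α - v.upper α| ≤ dist u v :=
  le_ciSup (bddAbove_dist u v) α

noncomputable instance : MetricSpace FuzzyNumber where
  dist_self u := by simp [dist_def]
  dist_comm u v := by simp only [dist_def, abs_sub_comm]
  dist_triangle u v w := by
    rw [dist_def u w]
    have : Nonempty (Icc (0 : ℝ) 1) := ⟨⟨0, by simp⟩⟩
    refine ciSup_le fun α => max_le ?_ ?_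
    · exact (abs_sub_le _ (v.lower α) _).trans (add_le_add
        ((le_max_left _ _).trans (le_dist u v α)) ((le_max_left _ _).trans (le_dist v w α)))
    · exact (abs_sub_le _ (v.upper α) _).trans (add_le_add
        ((le_max_right _ _).trans (le_dist u v α)) ((le_max_right _ _).trans (le_dist v w α)))
  eq_of_dist_eq_zero := by
    intro u v h
    refine ext_level fun α h0 h1 => ?_
    have := le_dist u v ⟨α, h0.le, h1⟩
    rw [h] at this
    have hl := abs_nonpos_iff.1 ((le_max_left _ _).trans this)
    have hr := abs_nonpos_iff.1 ((le_max_right _ _).trans this)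
    rw [level_eq_Icc u h0.le h1, level_eq_Icc v h0.le h1]
    rw [sub_eq_zero] at hl hr
    exact congrArg₂ Icc hl hr

/-- `J` is the fuzzy Riemann integral `∫_c^d ∫_a^b F(u, v) du dv` over the rectangle
`[a, b] × [c, d]` (`a ≤ b`, `c ≤ d`): the Riemann sums over grids `a = x₀ ≤ ⋯ ≤ x_m = b`, `c = y₀ ≤ ⋯ ≤ y_n = d`,
with an arbitrary tag in each cell, converge to `J` in the metric `D` as the mesh tends to `0`. -/
def HasRiemannIntegral (F : ℝ × ℝ → FuzzyNumber) (a b c d : ℝ) (J : FuzzyNumber) : Prop :=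
  ∀ ε > 0, ∃ δ > 0, ∀ (m n : ℕ) (x y : ℕ → ℝ) (ξ : ℕ → ℕ → ℝ × ℝ),
    x 0 = a → x m = b → y 0 = c → y n = d →
    (∀ i < m, x i ≤ x (i + 1) ∧ x (i + 1) - x i < δ) →
    (∀ j < n, y j ≤ y (j + 1) ∧ y (j + 1) - y j < δ) →
    (∀ i < m, ∀ j < n, ξ i j ∈ Icc (x i) (x (i + 1)) ×ˢ Icc (y j) (y (j + 1))) →
    dist (∑ i ∈ Finset.range m, ∑ j ∈ Finset.range n,
      ((x (i + 1) - x i) * (y (j + 1) - y j)) • F (ξ i j)) J < ε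

/-- Existence of the fuzzy Riemann integral over `[a, b] × [c, d]`. -/
def RiemannIntegrable (F : ℝ × ℝ → FuzzyNumber) (a b c d : ℝ) : Prop :=
  ∃ J, HasRiemannIntegral F a b c d J

open Classical in
/-- The fuzzy Riemann integral over `[a, b] × [c, d]` (and `0` if it does not exist). -/
noncomputable def riemannIntegral (F : ℝ × ℝ → FuzzyNumber) (a b c d : ℝ) : FuzzyNumber :=
  if h : RiemannIntegrable F a b c d then h.choose else 0

/-- The space `C_{2π}^{(F)}(ℝ²)` of continuous fuzzy valued functions on `ℝ²` that are
`2π`-periodic in each variable. -/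
def periodicContinuous : Set (ℝ × ℝ → FuzzyNumber) :=
  {f | Continuous f ∧ ∀ (x y : ℝ) (k : ℤ),
    f (x + 2 * k * Real.pi, y) = f (x, y) ∧ f (x, y + 2 * k * Real.pi) = f (x, y)}

/-- The Poisson kernel `ψ_r`. -/
noncomputable def poissonKernel (r x : ℝ) : ℝ := (1 - r ^ 2) / (1 - 2 * r * Real.cos x + r ^ 2)

/-- The integrand `(u, v) ↦ f(x - u, y - v) ψ_r(u) ψ_s(v)`. -/
noncomputable def abelPoissonIntegrand (r s : ℝ) (f : ℝ × ℝ → FuzzyNumber) (x y : ℝ) :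
    ℝ × ℝ → FuzzyNumber :=
  fun w => (poissonKernel r w.1 * poissonKernel s w.2) • f (x - w.1, y - w.2)

/-- The double fuzzy Abel–Poisson convolution operator `P_{rs}`. -/
noncomputable def abelPoisson (r s : ℝ) (f : ℝ × ℝ → FuzzyNumber) : ℝ × ℝ → FuzzyNumber :=
  fun z => (1 / (4 * Real.pi ^ 2)) •
    riemannIntegral (abelPoissonIntegrand r s f z.1 z.2) (-Real.pi) Real.pi (-Real.pi) Real.pi

/-- `(1/π²) ∫_{-π}^{π} ∫_{-π}^{π} g(x, y) p(jx) q(ky) dx dy`; with `p, q ∈ {cos, sin}` these are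
the double Fourier coefficients of `g`. -/
noncomputable def fourierCoef (p q : ℝ → ℝ) (g : ℝ × ℝ → ℝ) (j k : ℕ) : ℝ :=
  1 / Real.pi ^ 2 * ∫ y in (-Real.pi)..Real.pi, ∫ x in (-Real.pi)..Real.pi,
    g (x, y) * p (j * x) * q (k * y)

/-- The `(j, k)` term at `(x, y)` of the double Fourier series of `g : ℝ² → ℝ`. For
`g = f^-_α` (resp. `f^+_α`) this is the left (resp. right) double level Fourier series of the fuzzy
valued function `f`. -/
noncomputable def fourierTerm (g : ℝ × ℝ → ℝ) (x y : ℝ) : ℕ → ℕ → ℝ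
  | 0, 0 => fourierCoef Real.cos Real.cos g 0 0 / 4
  | j + 1, 0 => 1 / 2 *
      (fourierCoef Real.cos Real.cos g (j + 1) 0 * Real.cos ((j + 1 : ℕ) * x)
        + fourierCoef Real.sin Real.cos g (j + 1) 0 * Real.sin ((j + 1 : ℕ) * x))
  | 0, k + 1 => 1 / 2 *
      (fourierCoef Real.cos Real.cos g 0 (k + 1) * Real.cos ((k + 1 : ℕ) * y)
        + fourierCoef Real.cos Real.sin g 0 (k + 1) * Real.sin ((k + 1 : ℕ) * y))
  | j + 1, k + 1 =>
      fourierCoef Real.cos Real.cos g (j + 1) (k + 1)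
          * Real.cos ((j + 1 : ℕ) * x) * Real.cos ((k + 1 : ℕ) * y)
        + fourierCoef Real.cos Real.sin g (j + 1) (k + 1)
          * Real.cos ((j + 1 : ℕ) * x) * Real.sin ((k + 1 : ℕ) * y)
        + fourierCoef Real.sin Real.cos g (j + 1) (k + 1)
          * Real.sin ((j + 1 : ℕ) * x) * Real.cos ((k + 1 : ℕ) * y)
        + fourierCoef Real.sin Real.sin g (j + 1) (k + 1)
          * Real.sin ((j + 1 : ℕ) * x) * Real.sin ((k + 1 : ℕ) * y)

end FuzzyNumber

/-! The proof reduces everything to the real endpoint functions `f^∓_α`. Addition and nonnegative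
scalars act on endpoints as on real numbers, and `D` is the supremum over `α` of endpoint
differences, so a real estimate that is uniform in `α` is an estimate in `D` (`dist_le`).

For a continuous `F`, the integrals of the lower and upper endpoints are monotone in `α` in opposite
directions and left continuous by dominated convergence; hence they bound the level sets of a fuzzy
number `J`. One modulus of continuity of `F` in `D` serves all endpoints at once, so Riemann sums
converge to `J` (`hasRiemannIntegral_of_lower_upper`). The Poisson kernel is nonnegative, so the
endpoints of `P_rs f` are the ordinary Poisson integrals of `f^∓_α`. Expanding the kernel in its
absolutely convergent cosine series and integrating termwise gives the Abel means
(`hasSum_fourierTerm`).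

For the limit, positivity and unit mass bound `D(P_rs f(z), f(z))` by the Poisson mean of `D(f(z -
w), f(z))`. A Korovkin argument (`exists_dist_le_add_mul_one_sub_cos`) majorizes this distance,
uniformly in `z`, by `ε + B((1 - cos w₁) + (1 - cos w₂))`, whose Poisson mean is exactly `ε + B((1 -
r) + (1 - s))`. -/

namespace FuzzyNumber

/-! ### Endpoints of level sets: arithmetic, metric estimates, one-sided continuity in `α`. -/

theorem lower_le_of_mem (u : FuzzyNumber) {α t : ℝ} (h0 : 0 ≤ α) (ht : t ∈ u.level α) :
    u.lower α ≤ t :=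
  csInf_le (u.isCompact_level h0).bddBelow ht

theorem lower_le_upper (u : FuzzyNumber) {α : ℝ} (h0 : 0 ≤ α) (h1 : α ≤ 1) :
    u.lower α ≤ u.upper α :=
  u.lower_le_of_mem h0 (u.upper_mem h0 h1)

theorem lower_mono (u : FuzzyNumber) {α β : ℝ} (h0 : 0 ≤ α) (hab : α ≤ β) (h1 : β ≤ 1) :
    u.lower α ≤ u.lower β :=
  u.lower_le_of_mem h0 (u.level_anti h0 hab (u.lower_mem (h0.trans hab) h1))

theorem lower_add (u v : FuzzyNumber) {α : ℝ} (h0 : 0 ≤ α) (h1 : α ≤ 1) :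
    (u + v).lower α = u.lower α + v.lower α := by
  rw [lower, level_add u v h0 h1]
  exact csInf_add (u.nonempty_level h0 h1) (u.isCompact_level h0).bddBelow
    (v.nonempty_level h0 h1) (v.isCompact_level h0).bddBelow

theorem upper_add (u v : FuzzyNumber) {α : ℝ} (h0 : 0 ≤ α) (h1 : α ≤ 1) :
    (u + v).upper α = u.upper α + v.upper α := by
  rw [upper, level_add u v h0 h1]
  exact csSup_add (u.nonempty_level h0 h1) (u.isCompact_level h0).bddAbove
    (v.nonempty_level h0 h1) (v.isCompact_level h0).bddAbove

theorem lower_smul (u : FuzzyNumber) {k α : ℝ} (hk : 0 ≤ k) (h0 : 0 ≤ α) (h1 : α ≤ 1) :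
    (k • u).lower α = k * u.lower α := by
  rw [lower, level_smul k u h0 h1, Real.sInf_smul_of_nonneg hk, smul_eq_mul, lower]

theorem upper_smul (u : FuzzyNumber) {k α : ℝ} (hk : 0 ≤ k) (h0 : 0 ≤ α) (h1 : α ≤ 1) :
    (k • u).upper α = k * u.upper α := by
  rw [upper, level_smul k u h0 h1, Real.sSup_smul_of_nonneg hk, smul_eq_mul, upper]

/-- Reflection exchanges the two endpoints, which lets statements about `upper` be deduced from
those about `lower`. -/
theorem lower_neg_one_smul (u : FuzzyNumber) {α : ℝ} (h0 : 0 ≤ α) (h1 : α ≤ 1) :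
    ((-1 : ℝ) • u).lower α = -u.upper α := by
  rw [lower, level_smul _ u h0 h1, Real.sInf_smul_of_nonpos (by norm_num), smul_eq_mul, upper,
    neg_one_mul]

theorem level_zero_number' {α : ℝ} (h0 : 0 ≤ α) (h1 : α ≤ 1) :
    (0 : FuzzyNumber).level α = {0} := by
  rcases h0.eq_or_lt with rfl | h0
  · have : {t | 0 < (0 : FuzzyNumber).toFun t} = {0} := by
      ext t
      change 0 < ({0} : Set ℝ).indicator (1 : ℝ → ℝ) t ↔ t = 0
      by_cases h : t = 0 <;> simp [h]
    rw [level_zero, this, closure_singleton]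
  · exact level_zero_number h0 h1

theorem lower_zero {α : ℝ} (h0 : 0 ≤ α) (h1 : α ≤ 1) : (0 : FuzzyNumber).lower α = 0 := by
  rw [lower, level_zero_number' h0 h1, csInf_singleton]

theorem upper_zero {α : ℝ} (h0 : 0 ≤ α) (h1 : α ≤ 1) : (0 : FuzzyNumber).upper α = 0 := by
  rw [upper, level_zero_number' h0 h1, csSup_singleton]

theorem lower_sum {ι : Type*} (s : Finset ι) (u : ι → FuzzyNumber) {α : ℝ} (h0 : 0 ≤ α)
    (h1 : α ≤ 1) : (∑ i ∈ s, u i).lower α = ∑ i ∈ s, (u i).lower α := by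
  classical
  induction s using Finset.induction_on with
  | empty => simp [lower_zero h0 h1]
  | insert i s hi ih => rw [Finset.sum_insert hi, Finset.sum_insert hi, lower_add _ _ h0 h1, ih]

theorem upper_sum {ι : Type*} (s : Finset ι) (u : ι → FuzzyNumber) {α : ℝ} (h0 : 0 ≤ α)
    (h1 : α ≤ 1) : (∑ i ∈ s, u i).upper α = ∑ i ∈ s, (u i).upper α := by
  classical
  induction s using Finset.induction_on with
  | empty => simp [upper_zero h0 h1]
  | insert i s hi ih => rw [Finset.sum_insert hi, Finset.sum_insert hi, upper_add _ _ h0 h1, ih]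

theorem abs_lower_sub_le (u v : FuzzyNumber) {α : ℝ} (h : α ∈ Icc (0 : ℝ) 1) :
    |u.lower α - v.lower α| ≤ dist u v :=
  (le_max_left _ _).trans (le_dist u v ⟨α, h⟩)

theorem abs_upper_sub_le (u v : FuzzyNumber) {α : ℝ} (h : α ∈ Icc (0 : ℝ) 1) :
    |u.upper α - v.upper α| ≤ dist u v :=
  (le_max_right _ _).trans (le_dist u v ⟨α, h⟩)

theorem dist_le {u v : FuzzyNumber} {C : ℝ}
    (hl : ∀ α ∈ Icc (0 : ℝ) 1, |u.lower α - v.lower α| ≤ C)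
    (hu : ∀ α ∈ Icc (0 : ℝ) 1, |u.upper α - v.upper α| ≤ C) : dist u v ≤ C := by
  have : Nonempty (Icc (0 : ℝ) 1) := ⟨⟨0, by simp⟩⟩
  exact ciSup_le fun α => max_le (hl α α.2) (hu α α.2)

/-- A bound independent of `α`: `dist (F z) 0` becomes the dominating function when endpoints are
integrated. -/
theorem abs_lower_le (u : FuzzyNumber) {α : ℝ} (h : α ∈ Icc (0 : ℝ) 1) :
    |u.lower α| ≤ dist u 0 := by
  simpa [lower_zero h.1 h.2] using abs_lower_sub_le u 0 h

theorem abs_upper_le (u : FuzzyNumber) {α : ℝ} (h : α ∈ Icc (0 : ℝ) 1) :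
    |u.upper α| ≤ dist u 0 := by
  simpa [upper_zero h.1 h.2] using abs_upper_sub_le u 0 h

theorem continuous_lower {α : ℝ} (h : α ∈ Icc (0 : ℝ) 1) :
    Continuous fun u : FuzzyNumber => u.lower α :=
  (LipschitzWith.of_dist_le_mul (K := 1) fun u v => by
    simpa [Real.dist_eq] using abs_lower_sub_le u v h).continuous

theorem continuous_upper {α : ℝ} (h : α ∈ Icc (0 : ℝ) 1) :
    Continuous fun u : FuzzyNumber => u.upper α :=
  (LipschitzWith.of_dist_le_mul (K := 1) fun u v => by
    simpa [Real.dist_eq] using abs_upper_sub_le u v h).continuous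

/-- Endpointwise, `k p - l q = k (p - q) + (k - l) q`. Nonnegative scalars are required because
negative ones swap endpoints. -/
theorem dist_smul_smul_le (u v : FuzzyNumber) {k l : ℝ} (hk : 0 ≤ k) (hl : 0 ≤ l) :
    dist (k • u) (l • v) ≤ k * dist u v + |k - l| * dist v 0 := by
  have key : ∀ p q d e : ℝ, |p - q| ≤ d → |q| ≤ e → |k * p - l * q| ≤ k * d + |k - l| * e := by
    intro p q d e hd he
    calc |k * p - l * q| = |k * (p - q) + (k - l) * q| := by ring_nf
      _ ≤ |k * (p - q)| + |(k - l) * q| := abs_add_le _ _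
      _ = k * |p - q| + |k - l| * |q| := by rw [abs_mul, abs_mul, abs_of_nonneg hk]
      _ ≤ _ := by gcongr
  refine dist_le (fun α h => ?_) fun α h => ?_
  · rw [lower_smul u hk h.1 h.2, lower_smul v hl h.1 h.2]
    exact key _ _ _ _ (abs_lower_sub_le u v h) (abs_lower_le v h)
  · rw [upper_smul u hk h.1 h.2, upper_smul v hl h.1 h.2]
    exact key _ _ _ _ (abs_upper_sub_le u v h) (abs_upper_le v h)

theorem continuous_smul_of_nonneg {X : Type*} [TopologicalSpace X] {k : X → ℝ}
    {F : X → FuzzyNumber} (hk : Continuous k) (hk0 : ∀ x, 0 ≤ k x) (hF : Continuous F) :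
    Continuous fun x => k x • F x := by
  refine continuous_iff_continuousAt.2 fun x => tendsto_iff_dist_tendsto_zero.2 ?_
  have h : Tendsto (fun y => k y * dist (F y) (F x) + |k y - k x| * dist (F x) 0) (𝓝 x)
      (𝓝 (k x * dist (F x) (F x) + |k x - k x| * dist (F x) 0)) :=
    Continuous.tendsto (by fun_prop) x
  rw [dist_self, sub_self, abs_zero, mul_zero, zero_mul, add_zero] at h
  exact squeeze_zero (fun _ => dist_nonneg)
    (fun y => dist_smul_smul_le (F y) (F x) (hk0 y) (hk0 x)) h

/-- If the left limit fell short of `u^-_α`, some `t < u^-_α` would lie in every level `β < α`,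
hence in their intersection, which is the level `α`. -/
theorem tendsto_lower_nhdsLT (u : FuzzyNumber) {α : ℝ} (h0 : 0 < α) (h1 : α ≤ 1) :
    Tendsto u.lower (𝓝[<] α) (𝓝 (u.lower α)) := by
  refine (tendsto_order.2 ⟨fun t ht => ?_, fun t ht => ?_⟩)
  · by_contra hcon
    have hle : ∀ β ∈ Ioo 0 α, u.lower β ≤ t := by
      intro β hβ
      by_contra hlt
      refine hcon ?_
      filter_upwards [Ioo_mem_nhdsLT hβ.2] with γ hγ
      exact (not_le.1 hlt).trans_le (u.lower_mono hβ.1.le hγ.1.le (hγ.2.le.trans h1))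
    refine absurd (u.lower_le_of_mem h0.le (u.mem_level_of_forall_lt h0 fun β hβ => ?_))
      (not_le.2 ht)
    rw [level_eq_Icc u hβ.1.le (hβ.2.le.trans h1)]
    refine ⟨hle β hβ, ht.le.trans ((u.lower_le_upper h0.le h1).trans ?_)⟩
    have := u.level_anti hβ.1.le hβ.2.le (u.upper_mem h0.le h1)
    rw [level_eq_Icc u hβ.1.le (hβ.2.le.trans h1)] at this
    exact this.2
  · filter_upwards [Ioo_mem_nhdsLT h0] with β hβ
    exact (u.lower_mono hβ.1.le hβ.2.le h1).trans_lt ht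

/-- The level at `0` is the closure of the support, so near its left end there are points `x` of
positive membership; such an `x` lies in every level `0 < β < u(x)`. -/
theorem tendsto_lower_nhdsGT_zero (u : FuzzyNumber) :
    Tendsto u.lower (𝓝[>] 0) (𝓝 (u.lower 0)) := by
  refine (tendsto_order.2 ⟨fun t ht => ?_, fun t ht => ?_⟩)
  · filter_upwards [Ioo_mem_nhdsGT one_pos] with β hβ
    exact ht.trans_le (u.lower_mono le_rfl hβ.1.le hβ.2.le)
  · have hmem := u.lower_mem le_rfl zero_le_one
    rw [level_zero] at hmem
    obtain ⟨x, hxt, hx⟩ := mem_closure_iff.1 hmem (Iio t) isOpen_Iio ht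
    filter_upwards [Ioo_mem_nhdsGT hx] with β hβ
    refine (u.lower_le_of_mem hβ.1.le ?_).trans_lt hxt
    rw [level_pos u hβ.1]
    exact hβ.2.le

theorem tendsto_upper_nhdsLT (u : FuzzyNumber) {α : ℝ} (h0 : 0 < α) (h1 : α ≤ 1) :
    Tendsto u.upper (𝓝[<] α) (𝓝 (u.upper α)) := by
  have h := (((-1 : ℝ) • u).tendsto_lower_nhdsLT h0 h1).neg
  rw [lower_neg_one_smul u h0.le h1, neg_neg] at h
  refine h.congr' ?_
  filter_upwards [Ioo_mem_nhdsLT h0] with β hβ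
  rw [lower_neg_one_smul u hβ.1.le (hβ.2.le.trans h1), neg_neg]

theorem tendsto_upper_nhdsGT_zero (u : FuzzyNumber) :
    Tendsto u.upper (𝓝[>] 0) (𝓝 (u.upper 0)) := by
  have h := ((-1 : ℝ) • u).tendsto_lower_nhdsGT_zero.neg
  rw [lower_neg_one_smul u le_rfl zero_le_one, neg_neg] at h
  refine h.congr' ?_
  filter_upwards [Ioo_mem_nhdsGT one_pos] with β hβ
  rw [lower_neg_one_smul u hβ.1.le hβ.2.le, neg_neg]

theorem upper_anti (u : FuzzyNumber) {α β : ℝ} (h0 : 0 ≤ α) (hab : α ≤ β) (h1 : β ≤ 1) :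
    u.upper β ≤ u.upper α :=
  le_csSup (u.isCompact_level h0).bddAbove
    (u.level_anti h0 hab (u.upper_mem (h0.trans hab) h1))

end FuzzyNumber

/-! ### Iterated integrals of real functions over rectangles. -/

/-- The iterated integral of `g` over the rectangle `[a, b] × [c, d]`. -/
noncomputable def rectIntegral (a b c d : ℝ) (g : ℝ × ℝ → ℝ) : ℝ :=
  ∫ y in c..d, ∫ x in a..b, g (x, y)

section rectIntegral

variable {a b c d : ℝ} {g h : ℝ × ℝ → ℝ}

theorem continuous_inner_integral {g : ℝ × ℝ → ℝ} (a b : ℝ) (hg : Continuous g) :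
    Continuous fun y => ∫ x in a..b, g (x, y) :=
  intervalIntegral.continuous_parametric_intervalIntegral_of_continuous' (by fun_prop) a b

theorem rectIntegral_const (a b c d k : ℝ) :
    rectIntegral a b c d (fun _ => k) = (b - a) * (d - c) * k := by
  simp [rectIntegral]; ring

theorem rectIntegral_const_mul (k : ℝ) (g : ℝ × ℝ → ℝ) :
    rectIntegral a b c d (fun z => k * g z) = k * rectIntegral a b c d g := by
  simp [rectIntegral]

theorem rectIntegral_add (hg : Continuous g) (hh : Continuous h) :
    rectIntegral a b c d (fun z => g z + h z) =
      rectIntegral a b c d g + rectIntegral a b c d h := by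
  unfold rectIntegral
  rw [← intervalIntegral.integral_add
    ((continuous_inner_integral a b hg).intervalIntegrable _ _)
    ((continuous_inner_integral a b hh).intervalIntegrable _ _)]
  congr 1; ext y
  exact intervalIntegral.integral_add (Continuous.intervalIntegrable (by fun_prop) _ _)
    (Continuous.intervalIntegrable (by fun_prop) _ _)

theorem rectIntegral_sub (hg : Continuous g) (hh : Continuous h) :
    rectIntegral a b c d (fun z => g z - h z) =
      rectIntegral a b c d g - rectIntegral a b c d h := by
  have := rectIntegral_add (a := a) (b := b) (c := c) (d := d) (hg.sub hh) hh
  simp only [Pi.sub_apply, sub_add_cancel] at this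
  exact eq_sub_of_add_eq this.symm

theorem rectIntegral_finset_sum {ι : Type*} (s : Finset ι) {G : ι → ℝ × ℝ → ℝ}
    (hG : ∀ i, Continuous (G i)) :
    rectIntegral a b c d (fun z => ∑ i ∈ s, G i z) = ∑ i ∈ s, rectIntegral a b c d (G i) := by
  classical
  induction s using Finset.induction_on with
  | empty => simp [rectIntegral]
  | insert i s hi ih =>
    simp only [Finset.sum_insert hi]
    rw [rectIntegral_add (hG i) (by fun_prop), ih]

theorem rectIntegral_mono_on (hab : a ≤ b) (hcd : c ≤ d) (hg : Continuous g) (hh : Continuous h)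
    (hle : ∀ z ∈ Icc a b ×ˢ Icc c d, g z ≤ h z) :
    rectIntegral a b c d g ≤ rectIntegral a b c d h := by
  refine intervalIntegral.integral_mono_on hcd
    ((continuous_inner_integral a b hg).intervalIntegrable _ _)
    ((continuous_inner_integral a b hh).intervalIntegrable _ _) fun y hy => ?_
  exact intervalIntegral.integral_mono_on hab (Continuous.intervalIntegrable (by fun_prop) _ _)
    (Continuous.intervalIntegrable (by fun_prop) _ _) fun x hx => hle _ ⟨hx, hy⟩

theorem abs_rectIntegral_sub_le (hab : a ≤ b) (hcd : c ≤ d) {k : ℝ × ℝ → ℝ} (hg : Continuous g)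
    (hh : Continuous h) (hk : Continuous k)
    (hle : ∀ z ∈ Icc a b ×ˢ Icc c d, |g z - h z| ≤ k z) :
    |rectIntegral a b c d g - rectIntegral a b c d h| ≤ rectIntegral a b c d k := by
  rw [abs_le, neg_le_sub_iff_le_add, sub_le_iff_le_add', ← rectIntegral_add hg hk,
    ← rectIntegral_add hh hk]
  exact ⟨rectIntegral_mono_on hab hcd hh (by fun_prop) fun z hz => by
      linarith [(abs_le.1 (hle z hz)).1],
    rectIntegral_mono_on hab hcd hg (by fun_prop) fun z hz => by
      linarith [(abs_le.1 (hle z hz)).2]⟩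

theorem sum_rectIntegral_grid (hg : Continuous g) (m n : ℕ) (x y : ℕ → ℝ) :
    ∑ i ∈ Finset.range m, ∑ j ∈ Finset.range n,
      rectIntegral (x i) (x (i + 1)) (y j) (y (j + 1)) g =
        rectIntegral (x 0) (x m) (y 0) (y n) g := by
  have h1 : ∀ i, ∑ j ∈ Finset.range n, rectIntegral (x i) (x (i + 1)) (y j) (y (j + 1)) g =
      rectIntegral (x i) (x (i + 1)) (y 0) (y n) g := fun i =>
    intervalIntegral.sum_integral_adjacent_intervals fun j _ =>
      (continuous_inner_integral _ _ hg).intervalIntegrable _ _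
  simp only [h1]
  unfold rectIntegral
  rw [← intervalIntegral.integral_finsetSum fun i _ =>
    (continuous_inner_integral _ _ hg).intervalIntegrable _ _]
  congr 1; ext t
  exact intervalIntegral.sum_integral_adjacent_intervals fun j _ =>
    Continuous.intervalIntegrable (by fun_prop) _ _

/-- Dominated convergence for the outer integral, whose pointwise hypothesis is dominated
convergence for the inner one. -/
theorem tendsto_rectIntegral {ι : Type*} {l : Filter ι} [l.IsCountablyGenerated] (hab : a ≤ b)
    {G : ι → ℝ × ℝ → ℝ} {H : ℝ × ℝ → ℝ} (hH : Continuous H)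
    (hG : ∀ᶠ i in l, Continuous (G i)) (hGH : ∀ᶠ i in l, ∀ z, |G i z| ≤ H z)
    (hlim : ∀ z, Tendsto (fun i => G i z) l (𝓝 (g z))) :
    Tendsto (fun i => rectIntegral a b c d (G i)) l (𝓝 (rectIntegral a b c d g)) := by
  refine intervalIntegral.tendsto_integral_filter_of_dominated_convergence
    (fun y => ∫ x in a..b, H (x, y)) ?_ ?_
    ((continuous_inner_integral a b hH).intervalIntegrable _ _) ?_
  · filter_upwards [hG] with i hi
    exact (continuous_inner_integral a b hi).aestronglyMeasurable
  · filter_upwards [hGH] with i hi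
    refine .of_forall fun y _ => ?_
    exact intervalIntegral.norm_integral_le_of_norm_le hab (.of_forall fun x _ => hi _)
      (Continuous.intervalIntegrable (by fun_prop) _ _)
  · refine .of_forall fun y _ => ?_
    refine intervalIntegral.tendsto_integral_filter_of_dominated_convergence
      (fun x => H (x, y)) ?_ ?_ (Continuous.intervalIntegrable (by fun_prop) _ _)
      (.of_forall fun x _ => hlim _)
    · filter_upwards [hG] with i hi
      exact Continuous.aestronglyMeasurable (by fun_prop)
    · filter_upwards [hGH] with i hi
      exact .of_forall fun x _ => hi _

/-- Unconditional sums are limits along finite subsets. Countability of `ι` makes that filter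
countably generated, and all partial sums are dominated by `(∑' i, k i) * H`. -/
theorem hasSum_rectIntegral {ι : Type*} [Countable ι] (hab : a ≤ b)
    {G : ι → ℝ × ℝ → ℝ} {H : ℝ × ℝ → ℝ} {k : ι → ℝ} (hH : Continuous H)
    (hG : ∀ i, Continuous (G i)) (hk : Summable k) (hk0 : ∀ i, 0 ≤ k i) (hH0 : ∀ z, 0 ≤ H z)
    (hGH : ∀ i z, |G i z| ≤ k i * H z)
    (hsum : ∀ z, HasSum (fun i => G i z) (g z)) :
    HasSum (fun i => rectIntegral a b c d (G i)) (rectIntegral a b c d g) := by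
  have key : Tendsto (fun s : Finset ι => rectIntegral a b c d (fun z => ∑ i ∈ s, G i z)) atTop
      (𝓝 (rectIntegral a b c d g)) := by
    refine tendsto_rectIntegral (H := fun z => (∑' i, k i) * H z) hab (by fun_prop)
      (.of_forall fun s => by fun_prop) (.of_forall fun s z => ?_) hsum
    calc |∑ i ∈ s, G i z| ≤ ∑ i ∈ s, |G i z| := Finset.abs_sum_le_sum_abs _ _
      _ ≤ ∑ i ∈ s, k i * H z := Finset.sum_le_sum fun i _ => hGH i z
      _ = (∑ i ∈ s, k i) * H z := (Finset.sum_mul _ _ _).symm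
      _ ≤ _ := mul_le_mul_of_nonneg_right (hk.sum_le_tsum s fun i _ => hk0 i) (hH0 z)
  simp only [rectIntegral_finset_sum _ hG] at key
  exact key

end rectIntegral

/-! ### The fuzzy Riemann integral of a continuous function. -/

namespace FuzzyNumber

section RiemannIntegral

variable {F : ℝ × ℝ → FuzzyNumber} {a b c d : ℝ}

theorem tendsto_rectIntegral_lower (hF : Continuous F) (hab : a ≤ b) {l : Filter ℝ}
    [l.IsCountablyGenerated] {α : ℝ} (hl : ∀ᶠ β in l, β ∈ Icc (0 : ℝ) 1)
    (h : ∀ u : FuzzyNumber, Tendsto u.lower l (𝓝 (u.lower α))) :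
    Tendsto (fun β => rectIntegral a b c d fun z => (F z).lower β) l
      (𝓝 (rectIntegral a b c d fun z => (F z).lower α)) := by
  refine tendsto_rectIntegral (H := fun z => dist (F z) 0) hab (by fun_prop) ?_ ?_ fun z => h _
  · filter_upwards [hl] with β hβ using (continuous_lower hβ).comp hF
  · filter_upwards [hl] with β hβ z using abs_lower_le _ hβ

theorem tendsto_rectIntegral_upper (hF : Continuous F) (hab : a ≤ b) {l : Filter ℝ}
    [l.IsCountablyGenerated] {α : ℝ} (hl : ∀ᶠ β in l, β ∈ Icc (0 : ℝ) 1)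
    (h : ∀ u : FuzzyNumber, Tendsto u.upper l (𝓝 (u.upper α))) :
    Tendsto (fun β => rectIntegral a b c d fun z => (F z).upper β) l
      (𝓝 (rectIntegral a b c d fun z => (F z).upper α)) := by
  refine tendsto_rectIntegral (H := fun z => dist (F z) 0) hab (by fun_prop) ?_ ?_ fun z => h _
  · filter_upwards [hl] with β hβ using (continuous_upper hβ).comp hF
  · filter_upwards [hl] with β hβ z using abs_upper_le _ hβ

/-- The endpoints of the level sets of a fuzzy number can be integrated level by level. -/
theorem exists_lower_upper_eq_rectIntegral (hF : Continuous F) (hab : a ≤ b) (hcd : c ≤ d) :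
    ∃ J : FuzzyNumber, ∀ α ∈ Icc (0 : ℝ) 1,
      J.lower α = rectIntegral a b c d (fun z => (F z).lower α) ∧
      J.upper α = rectIntegral a b c d (fun z => (F z).upper α) := by
  set L : ℝ → ℝ := fun α => rectIntegral a b c d fun z => (F z).lower α with hL
  set U : ℝ → ℝ := fun α => rectIntegral a b c d fun z => (F z).upper α with hU
  have cl : ∀ α ∈ Icc (0 : ℝ) 1, Continuous fun z => (F z).lower α :=
    fun α h => (continuous_lower h).comp hF
  have cu : ∀ α ∈ Icc (0 : ℝ) 1, Continuous fun z => (F z).upper α :=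
    fun α h => (continuous_upper h).comp hF
  have memI : ∀ {α : ℝ}, 0 < α → α ≤ 1 → α ∈ Icc (0 : ℝ) 1 := fun h0 h1 => ⟨h0.le, h1⟩
  have hLU : ∀ α ∈ Icc (0 : ℝ) 1, L α ≤ U α := fun α h =>
    rectIntegral_mono_on hab hcd (cl α h) (cu α h) fun z _ => lower_le_upper _ h.1 h.2
  have hLm : ∀ α β, 0 ≤ α → α ≤ β → β ≤ 1 → L α ≤ L β := fun α β h0 h h1 =>
    rectIntegral_mono_on hab hcd (cl α ⟨h0, h.trans h1⟩) (cl β ⟨h0.trans h, h1⟩)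
      fun z _ => lower_mono _ h0 h h1
  have hUm : ∀ α β, 0 ≤ α → α ≤ β → β ≤ 1 → U β ≤ U α := fun α β h0 h h1 =>
    rectIntegral_mono_on hab hcd (cu β ⟨h0.trans h, h1⟩) (cu α ⟨h0, h.trans h1⟩)
      fun z _ => upper_anti _ h0 h h1
  have anti : ∀ α β, 0 < α → α ≤ β → β ≤ 1 → Icc (L β) (U β) ⊆ Icc (L α) (U α) :=
    fun α β h0 h h1 => Icc_subset_Icc (hLm α β h0.le h h1) (hUm α β h0.le h h1)
  -- Left continuity of `L` and `U` is inherited from the integrands by dominated convergence.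
  have left : ∀ α, 0 < α → α ≤ 1 → ∀ t, (∀ β, 0 < β → β < α → t ∈ Icc (L β) (U β)) →
      t ∈ Icc (L α) (U α) := by
    intro α h0 h1 t ht
    have hev : ∀ᶠ β in 𝓝[<] α, β ∈ Ioo 0 α := Ioo_mem_nhdsLT h0
    have hev' : ∀ᶠ β in 𝓝[<] α, β ∈ Icc (0 : ℝ) 1 :=
      hev.mono fun β hβ => ⟨hβ.1.le, hβ.2.le.trans h1⟩
    exact ⟨le_of_tendsto (tendsto_rectIntegral_lower hF hab hev'
        fun u => u.tendsto_lower_nhdsLT h0 h1) (hev.mono fun β hβ => (ht β hβ.1 hβ.2).1),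
      ge_of_tendsto (tendsto_rectIntegral_upper hF hab hev'
        fun u => u.tendsto_upper_nhdsLT h0 h1) (hev.mono fun β hβ => (ht β hβ.1 hβ.2).2)⟩
  let J : FuzzyNumber := ofLevels (fun α => Icc (L α) (U α))
    (nonempty_Icc.2 (hLU 1 (by simp))) (fun _ _ _ => isClosed_Icc) (fun _ _ _ => convex_Icc _ _)
    anti left ⟨Icc (L 0) (U 0), isCompact_Icc, fun α h0 h1 =>
      Icc_subset_Icc (hLm 0 α le_rfl h0.le h1) (hUm 0 α le_rfl h0.le h1)⟩
  have hJ : ∀ α, 0 < α → α ≤ 1 → J.level α = Icc (L α) (U α) := by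
    intro α h0 h1
    rw [level_pos _ h0]
    ext t
    exact le_ofLevelsFun_iff (K := fun α => Icc (L α) (U α)) anti left h0 h1 t
  have hJl : ∀ α, 0 < α → α ≤ 1 → J.lower α = L α := fun α h0 h1 => by
    rw [lower, hJ α h0 h1, csInf_Icc (hLU α (memI h0 h1))]
  have hJu : ∀ α, 0 < α → α ≤ 1 → J.upper α = U α := fun α h0 h1 => by
    rw [upper, hJ α h0 h1, csSup_Icc (hLU α (memI h0 h1))]
  refine ⟨J, fun α hα => ?_⟩
  -- `ofLevels` prescribes only the levels with `α > 0`; at `α = 0` both sides are limits of their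
  -- values as `β → 0⁺`.
  rcases hα.1.eq_or_lt with rfl | h0
  · have hev : ∀ᶠ β in 𝓝[>] (0 : ℝ), β ∈ Ioo (0 : ℝ) 1 := Ioo_mem_nhdsGT one_pos
    have hev' : ∀ᶠ β in 𝓝[>] (0 : ℝ), β ∈ Icc (0 : ℝ) 1 :=
      hev.mono fun β hβ => ⟨hβ.1.le, hβ.2.le⟩
    exact ⟨tendsto_nhds_unique (J.tendsto_lower_nhdsGT_zero.congr'
        (hev.mono fun β hβ => hJl β hβ.1 hβ.2.le))
        (tendsto_rectIntegral_lower hF hab hev' tendsto_lower_nhdsGT_zero),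
      tendsto_nhds_unique (J.tendsto_upper_nhdsGT_zero.congr'
        (hev.mono fun β hβ => hJu β hβ.1 hβ.2.le))
        (tendsto_rectIntegral_upper hF hab hev' tendsto_upper_nhdsGT_zero)⟩
  · exact ⟨hJl α h0 hα.2, hJu α h0 hα.2⟩

/-- Each term of the sum is the integral of a constant over its cell, and the error bound is the
integral of `ε`; splitting all three over the same grid leaves a comparison on one cell. -/
theorem abs_riemannSum_sub_rectIntegral_le {g : ℝ × ℝ → ℝ} (hg : Continuous g) {m n : ℕ}
    {x y : ℕ → ℝ} {ξ : ℕ → ℕ → ℝ × ℝ} {ε : ℝ}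
    (hx : ∀ i < m, x i ≤ x (i + 1)) (hy : ∀ j < n, y j ≤ y (j + 1))
    (hε : ∀ i < m, ∀ j < n, ∀ z ∈ Icc (x i) (x (i + 1)) ×ˢ Icc (y j) (y (j + 1)),
      |g (ξ i j) - g z| ≤ ε) :
    |(∑ i ∈ Finset.range m, ∑ j ∈ Finset.range n,
      ((x (i + 1) - x i) * (y (j + 1) - y j)) * g (ξ i j)) -
        rectIntegral (x 0) (x m) (y 0) (y n) g| ≤ (x m - x 0) * (y n - y 0) * ε := by
  rw [← sum_rectIntegral_grid hg, ← rectIntegral_const,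
    ← sum_rectIntegral_grid continuous_const, ← Finset.sum_sub_distrib]
  refine (Finset.abs_sum_le_sum_abs _ _).trans (Finset.sum_le_sum fun i hi => ?_)
  rw [← Finset.sum_sub_distrib]
  refine (Finset.abs_sum_le_sum_abs _ _).trans (Finset.sum_le_sum fun j hj => ?_)
  rw [Finset.mem_range] at hi hj
  rw [← rectIntegral_const]
  exact abs_rectIntegral_sub_le (hx i hi) (hy j hj) continuous_const hg continuous_const
    (hε i hi j hj)

theorem hasRiemannIntegral_of_lower_upper (hF : Continuous F) (hab : a ≤ b) (hcd : c ≤ d)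
    {J : FuzzyNumber} (hJ : ∀ α ∈ Icc (0 : ℝ) 1,
      J.lower α = rectIntegral a b c d (fun z => (F z).lower α) ∧
      J.upper α = rectIntegral a b c d (fun z => (F z).upper α)) :
    HasRiemannIntegral F a b c d J := by
  intro ε hε
  have hA : 0 ≤ (b - a) * (d - c) := mul_nonneg (sub_nonneg.2 hab) (sub_nonneg.2 hcd)
  -- The `+ 1` keeps the denominator positive on a degenerate rectangle and makes the final bound,
  -- area times this quantity, strictly less than `ε`.
  obtain ⟨δ, hδ, hδF⟩ := Metric.uniformContinuousOn_iff.1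
    ((isCompact_Icc.prod isCompact_Icc).uniformContinuousOn_of_continuous
      (s := Icc a b ×ˢ Icc c d) hF.continuousOn) (ε / ((b - a) * (d - c) + 1)) (by positivity)
  refine ⟨δ, hδ, ?_⟩
  rintro m n x y ξ rfl rfl rfl rfl hx hy hξ
  have hmono : ∀ {x : ℕ → ℝ} {m : ℕ}, (∀ i < m, x i ≤ x (i + 1) ∧ x (i + 1) - x i < δ) →
      ∀ i < m, Icc (x i) (x (i + 1)) ⊆ Icc (x 0) (x m) := by
    intro x m hx i hi
    have hM : MonotoneOn x (Iic m) := monotoneOn_of_le_succ ordConnected_Iic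
      fun i _ _ hi => (hx i (Order.succ_le_iff.1 hi)).1
    exact Icc_subset_Icc (hM (mem_Iic.2 (Nat.zero_le m)) (mem_Iic.2 hi.le) (Nat.zero_le i))
      (hM (mem_Iic.2 hi) (mem_Iic.2 le_rfl) hi)
  have hcell : ∀ i < m, ∀ j < n, ∀ z ∈ Icc (x i) (x (i + 1)) ×ˢ Icc (y j) (y (j + 1)),
      dist (F (ξ i j)) (F z) ≤ ε / ((x m - x 0) * (y n - y 0) + 1) := by
    intro i hi j hj z hz
    have hm := hξ i hi j hj
    refine (hδF _ ⟨hmono hx i hi hm.1, hmono hy j hj hm.2⟩ z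
      ⟨hmono hx i hi hz.1, hmono hy j hj hz.2⟩ ?_).le
    rw [Prod.dist_eq]
    exact max_lt ((Real.dist_le_of_mem_Icc hm.1 hz.1).trans_lt (hx i hi).2)
      ((Real.dist_le_of_mem_Icc hm.2 hz.2).trans_lt (hy j hj).2)
  have hk : ∀ i ∈ Finset.range m, ∀ j ∈ Finset.range n,
      0 ≤ (x (i + 1) - x i) * (y (j + 1) - y j) := fun i hi j hj =>
    mul_nonneg (sub_nonneg.2 (hx i (Finset.mem_range.1 hi)).1)
      (sub_nonneg.2 (hy j (Finset.mem_range.1 hj)).1)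
  refine lt_of_le_of_lt (b := (x m - x 0) * (y n - y 0) *
    (ε / ((x m - x 0) * (y n - y 0) + 1))) (dist_le (fun α hα => ?_) fun α hα => ?_) ?_
  · rw [(hJ α hα).1, lower_sum _ _ hα.1 hα.2, Finset.sum_congr rfl fun i hi =>
      (lower_sum _ _ hα.1 hα.2).trans (Finset.sum_congr rfl fun j hj =>
        lower_smul _ (hk i hi j hj) hα.1 hα.2)]
    exact abs_riemannSum_sub_rectIntegral_le ((continuous_lower hα).comp hF)
      (fun i hi => (hx i hi).1) (fun j hj => (hy j hj).1)
      fun i hi j hj z hz => (abs_lower_sub_le _ _ hα).trans (hcell i hi j hj z hz)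
  · rw [(hJ α hα).2, upper_sum _ _ hα.1 hα.2, Finset.sum_congr rfl fun i hi =>
      (upper_sum _ _ hα.1 hα.2).trans (Finset.sum_congr rfl fun j hj =>
        upper_smul _ (hk i hi j hj) hα.1 hα.2)]
    exact abs_riemannSum_sub_rectIntegral_le ((continuous_upper hα).comp hF)
      (fun i hi => (hx i hi).1) (fun j hj => (hy j hj).1)
      fun i hi j hj z hz => (abs_upper_sub_le _ _ hα).trans (hcell i hi j hj z hz)
  · rw [← mul_div_assoc, div_lt_iff₀ (by positivity)]
    linarith

theorem exists_uniform_grid {δ : ℝ} (hδ : 0 < δ) (hab : a ≤ b) :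
    ∃ (m : ℕ) (x : ℕ → ℝ), x 0 = a ∧ x m = b ∧
      ∀ i < m, x i ≤ x (i + 1) ∧ x (i + 1) - x i < δ := by
  obtain ⟨m, hm⟩ := exists_nat_gt ((b - a) / δ)
  have hm0 : (0 : ℝ) < m := (div_nonneg (sub_nonneg.2 hab) hδ.le).trans_lt hm
  have hstep : ∀ i : ℕ, a + (i + 1 : ℕ) * ((b - a) / m) - (a + i * ((b - a) / m)) =
      (b - a) / m := fun i => by push_cast; ring
  refine ⟨m, fun i => a + i * ((b - a) / m), by simp, by field_simp; ring, fun i _ => ⟨?_, ?_⟩⟩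
  · rw [← sub_nonneg, hstep]
    exact div_nonneg (sub_nonneg.2 hab) hm0.le
  · rw [hstep, div_lt_iff₀ hm0, mul_comm]
    exact (div_lt_iff₀ hδ).1 hm

/-- Grids of arbitrarily small mesh exist, so a single Riemann sum is close to both values. -/
theorem HasRiemannIntegral.unique {J J' : FuzzyNumber} (hab : a ≤ b) (hcd : c ≤ d)
    (h : HasRiemannIntegral F a b c d J) (h' : HasRiemannIntegral F a b c d J') : J = J' := by
  refine eq_of_forall_dist_le fun ε hε => ?_
  obtain ⟨δ, hδ, hJ⟩ := h (ε / 2) (half_pos hε)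
  obtain ⟨δ', hδ', hJ'⟩ := h' (ε / 2) (half_pos hε)
  obtain ⟨m, x, hx0, hxm, hx⟩ := exists_uniform_grid (lt_min hδ hδ') hab
  obtain ⟨n, y, hy0, hyn, hy⟩ := exists_uniform_grid (lt_min hδ hδ') hcd
  have hξ : ∀ i < m, ∀ j < n, (x i, y j) ∈ Icc (x i) (x (i + 1)) ×ˢ Icc (y j) (y (j + 1)) :=
    fun i hi j hj => ⟨left_mem_Icc.2 (hx i hi).1, left_mem_Icc.2 (hy j hj).1⟩
  have h1 := hJ m n x y (fun i j => (x i, y j)) hx0 hxm hy0 hyn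
    (fun i hi => ⟨(hx i hi).1, (hx i hi).2.trans_le (min_le_left _ _)⟩)
    (fun i hi => ⟨(hy i hi).1, (hy i hi).2.trans_le (min_le_left _ _)⟩) hξ
  have h2 := hJ' m n x y (fun i j => (x i, y j)) hx0 hxm hy0 hyn
    (fun i hi => ⟨(hx i hi).1, (hx i hi).2.trans_le (min_le_right _ _)⟩)
    (fun i hi => ⟨(hy i hi).1, (hy i hi).2.trans_le (min_le_right _ _)⟩) hξ
  linarith [dist_triangle_left J J' (∑ i ∈ Finset.range m, ∑ j ∈ Finset.range n,
    ((x (i + 1) - x i) * (y (j + 1) - y j)) • F (x i, y j))]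

/-- A continuous fuzzy valued function is Riemann integrable. -/
theorem riemannIntegrable_of_continuous (hF : Continuous F) (hab : a ≤ b) (hcd : c ≤ d) :
    RiemannIntegrable F a b c d := by
  obtain ⟨J, hJ⟩ := exists_lower_upper_eq_rectIntegral hF hab hcd
  exact ⟨J, hasRiemannIntegral_of_lower_upper hF hab hcd hJ⟩

/-- The Riemann integral of a continuous fuzzy valued function is computed level by level. -/
theorem lower_upper_riemannIntegral (hF : Continuous F) (hab : a ≤ b) (hcd : c ≤ d) {α : ℝ}
    (hα : α ∈ Icc (0 : ℝ) 1) :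
    (riemannIntegral F a b c d).lower α = rectIntegral a b c d (fun z => (F z).lower α) ∧
    (riemannIntegral F a b c d).upper α = rectIntegral a b c d (fun z => (F z).upper α) := by
  obtain ⟨J, hJ⟩ := exists_lower_upper_eq_rectIntegral hF hab hcd
  have hint := riemannIntegrable_of_continuous hF hab hcd
  have : riemannIntegral F a b c d = J := by
    rw [riemannIntegral, dif_pos hint]
    exact hint.choose_spec.unique hab hcd (hasRiemannIntegral_of_lower_upper hF hab hcd hJ)
  rw [this]
  exact hJ α hα

end RiemannIntegral

/-! ### The Poisson kernel: positivity, cosine expansion, moments. -/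

/-- Since `cos x ≤ 1` and `r ≥ 0`, the denominator is at least `(1 - r)²`. -/
theorem poissonKernel_denom_pos {r : ℝ} (hr : r ∈ Ico (0 : ℝ) 1) (x : ℝ) :
    0 < 1 - 2 * r * Real.cos x + r ^ 2 := by
  nlinarith [mul_le_mul_of_nonneg_left (Real.cos_le_one x) hr.1, sq_pos_of_pos (sub_pos.2 hr.2)]

theorem poissonKernel_nonneg {r : ℝ} (hr : r ∈ Ico (0 : ℝ) 1) (x : ℝ) :
    0 ≤ poissonKernel r x :=
  div_nonneg (by nlinarith [hr.1, hr.2]) (poissonKernel_denom_pos hr x).le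

theorem continuous_poissonKernel {r : ℝ} (hr : r ∈ Ico (0 : ℝ) 1) :
    Continuous (poissonKernel r) :=
  Continuous.div (by fun_prop) (by fun_prop) fun x => (poissonKernel_denom_pos hr x).ne'

theorem poissonKernel_sub_two_pi (r x : ℝ) :
    poissonKernel r (x - 2 * Real.pi) = poissonKernel r x := by
  simp [poissonKernel]

/-- The coefficients `1, 2, 2, …` of the cosine expansion of the Poisson kernel. -/
def cosWeight (j : ℕ) : ℝ := if j = 0 then 1 else 2

theorem cosWeight_nonneg (j : ℕ) : 0 ≤ cosWeight j := by
  unfold cosWeight; split_ifs <;> norm_num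

theorem cosWeight_le_two (j : ℕ) : cosWeight j ≤ 2 := by
  unfold cosWeight; split_ifs <;> norm_num

/-- This is the real part of the geometric series in `r e^{ix}`. -/
theorem hasSum_pow_mul_cos {r : ℝ} (hr : r ∈ Ico (0 : ℝ) 1) (x : ℝ) :
    HasSum (fun j : ℕ => r ^ j * Real.cos (j * x))
      ((1 - r * Real.cos x) / (1 - 2 * r * Real.cos x + r ^ 2)) := by
  have hz : ‖(r : ℂ) * Complex.exp (x * Complex.I)‖ < 1 := by
    rw [norm_mul, Complex.norm_exp_ofReal_mul_I, mul_one, Complex.norm_real, Real.norm_eq_abs,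
      abs_of_nonneg hr.1]
    exact hr.2
  have h := Complex.hasSum_re (hasSum_geometric_of_norm_lt_one hz)
  have hre : ∀ t : ℝ, (Complex.exp (t * Complex.I)).re = Real.cos t := Complex.exp_ofReal_mul_I_re
  have him : ∀ t : ℝ, (Complex.exp (t * Complex.I)).im = Real.sin t := Complex.exp_ofReal_mul_I_im
  convert h using 1
  · ext j
    rw [mul_pow, ← Complex.exp_nat_mul, ← mul_assoc, ← Complex.ofReal_pow, Complex.re_ofReal_mul,
      ← Complex.ofReal_natCast, ← Complex.ofReal_mul, hre]
  · rw [Complex.inv_re, Complex.normSq_apply]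
    simp only [Complex.sub_re, Complex.one_re, Complex.re_ofReal_mul, Complex.sub_im,
      Complex.one_im, Complex.im_ofReal_mul, hre, him]
    congr 1
    nlinarith [Real.sin_sq_add_cos_sq x]

theorem hasSum_poissonKernel {r : ℝ} (hr : r ∈ Ico (0 : ℝ) 1) (x : ℝ) :
    HasSum (fun j : ℕ => cosWeight j * r ^ j * Real.cos (j * x)) (poissonKernel r x) := by
  -- The kernel is `2 Re (1 / (1 - r e^{ix})) - 1`; subtracting `1` at index `0` turns the weight
  -- `2` there into `1`.
  have h := ((hasSum_pow_mul_cos hr x).mul_left 2).sub (hasSum_ite_eq (0 : ℕ) (1 : ℝ))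
  have e : poissonKernel r x =
      2 * ((1 - r * Real.cos x) / (1 - 2 * r * Real.cos x + r ^ 2)) - 1 := by
    have := (poissonKernel_denom_pos hr x).ne'
    rw [poissonKernel, mul_div_assoc', div_sub_one this]
    ring
  rw [e]
  refine Eq.mpr (congrArg (fun F => HasSum F _) (funext fun j => ?_)) h
  rcases eq_or_ne j 0 with rfl | hj
  · norm_num [cosWeight]
  · simp [cosWeight, hj, mul_assoc]

theorem abs_cosWeight_term_le {r : ℝ} (hr : 0 ≤ r) (j : ℕ) (t : ℝ) :
    |cosWeight j * r ^ j * Real.cos t| ≤ 2 * r ^ j := by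
  rw [abs_mul, abs_of_nonneg (mul_nonneg (cosWeight_nonneg j) (pow_nonneg hr j))]
  calc cosWeight j * r ^ j * |Real.cos t| ≤ 2 * r ^ j * 1 := by
        gcongr
        · exact cosWeight_le_two j
        · exact Real.abs_cos_le_one t
    _ = _ := mul_one _

theorem integral_poissonKernel {r : ℝ} (hr : r ∈ Ico (0 : ℝ) 1) :
    ∫ x in (-Real.pi)..Real.pi, poissonKernel r x = 2 * Real.pi := by
  have h := intervalIntegral.hasSum_integral_of_dominated_convergence
    (a := -Real.pi) (b := Real.pi) (μ := volume)
    (F := fun (j : ℕ) x => cosWeight j * r ^ j * Real.cos (j * x))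
    (f := poissonKernel r) (fun j _ => 2 * r ^ j)
    (fun j => Continuous.aestronglyMeasurable (by fun_prop))
    (fun j => .of_forall fun x _ => abs_cosWeight_term_le hr.1 j _)
    (.of_forall fun x _ => (summable_geometric_of_lt_one hr.1 hr.2).mul_left 2)
    (by simp) (.of_forall fun x _ => hasSum_poissonKernel hr x)
  have h0 : ∀ j : ℕ, j ≠ 0 →
      ∫ x in (-Real.pi)..Real.pi, cosWeight j * r ^ j * Real.cos (j * x) = 0 := by
    intro j hj
    rw [intervalIntegral.integral_const_mul,
      intervalIntegral.integral_comp_mul_left _ (Nat.cast_ne_zero.2 hj), integral_cos]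
    simp [Real.sin_nat_mul_pi]
  refine (h.unique (hasSum_single 0 h0)).trans ?_
  simp [cosWeight]; ring

/-- The relation `ψ_r(x) (1 - 2 r cos x + r²) = 1 - r²` can be solved for `ψ_r(x) cos x` when `r ≠
0`, which reduces the integral to the total mass of `ψ_r`. -/
theorem integral_poissonKernel_mul_cos {r : ℝ} (hr : r ∈ Ioo (0 : ℝ) 1) :
    ∫ x in (-Real.pi)..Real.pi, poissonKernel r x * Real.cos x = 2 * Real.pi * r := by
  have hr' : r ∈ Ico (0 : ℝ) 1 := ⟨hr.1.le, hr.2⟩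
  have hc := continuous_poissonKernel hr'
  have hpt : ∀ x, poissonKernel r x * Real.cos x =
      (1 + r ^ 2) / (2 * r) * poissonKernel r x - (1 - r ^ 2) / (2 * r) := by
    intro x
    have hmul : poissonKernel r x * (1 - 2 * r * Real.cos x + r ^ 2) = 1 - r ^ 2 :=
      div_mul_cancel₀ _ (poissonKernel_denom_pos hr' x).ne'
    have := hr.1.ne'
    field_simp
    linear_combination -hmul
  simp only [hpt]
  rw [intervalIntegral.integral_sub ((hc.intervalIntegrable _ _).const_mul _)
    (by simp), intervalIntegral.integral_const_mul, integral_poissonKernel hr',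
    intervalIntegral.integral_const, smul_eq_mul]
  have := hr.1.ne'
  field_simp
  ring

theorem rectIntegral_mul (a b c d : ℝ) (p q : ℝ → ℝ) :
    rectIntegral a b c d (fun z => p z.1 * q z.2) = (∫ x in a..b, p x) * ∫ y in c..d, q y := by
  simp [rectIntegral]

theorem rectIntegral_poissonKernel {r s : ℝ} (hr : r ∈ Ico (0 : ℝ) 1) (hs : s ∈ Ico (0 : ℝ) 1) :
    rectIntegral (-Real.pi) Real.pi (-Real.pi) Real.pi
      (fun w => poissonKernel r w.1 * poissonKernel s w.2) = 4 * Real.pi ^ 2 := by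
  rw [rectIntegral_mul, integral_poissonKernel hr, integral_poissonKernel hs]; ring

/-- The Poisson mean of the Korovkin test functions is exact: `1 - cos` averages to `1 - r` in the
first variable and `1 - s` in the second. -/
theorem rectIntegral_poissonKernel_mul_cos {r s : ℝ} (hr : r ∈ Ioo (0 : ℝ) 1)
    (hs : s ∈ Ioo (0 : ℝ) 1) (A B : ℝ) :
    rectIntegral (-Real.pi) Real.pi (-Real.pi) Real.pi
      (fun w => poissonKernel r w.1 * poissonKernel s w.2 *
        (A + B * ((1 - Real.cos w.1) + (1 - Real.cos w.2)))) =
      4 * Real.pi ^ 2 * (A + B * ((1 - r) + (1 - s))) := by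
  have hr' : r ∈ Ico (0 : ℝ) 1 := ⟨hr.1.le, hr.2⟩
  have hs' : s ∈ Ico (0 : ℝ) 1 := ⟨hs.1.le, hs.2⟩
  have hcr := continuous_poissonKernel hr'
  have hcs := continuous_poissonKernel hs'
  have hpt : (fun w : ℝ × ℝ => poissonKernel r w.1 * poissonKernel s w.2 *
        (A + B * ((1 - Real.cos w.1) + (1 - Real.cos w.2)))) = fun w =>
      (A + 2 * B) * (poissonKernel r w.1 * poissonKernel s w.2) -
        B * (poissonKernel r w.1 * Real.cos w.1 * poissonKernel s w.2) -
        B * (poissonKernel r w.1 * (poissonKernel s w.2 * Real.cos w.2)) := by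
    ext w; ring
  rw [hpt, rectIntegral_sub (by fun_prop) (by fun_prop),
    rectIntegral_sub (by fun_prop) (by fun_prop)]
  simp only [rectIntegral_const_mul]
  rw [rectIntegral_poissonKernel hr' hs',
    rectIntegral_mul _ _ _ _ (fun x => poissonKernel r x * Real.cos x) (poissonKernel s),
    rectIntegral_mul _ _ _ _ (poissonKernel r) (fun x => poissonKernel s x * Real.cos x),
    integral_poissonKernel hr', integral_poissonKernel hs', integral_poissonKernel_mul_cos hr,
    integral_poissonKernel_mul_cos hs]
  ring

/-! ### Double Fourier series and their Abel means. -/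

theorem integral_comp_sub_left_of_periodic {h : ℝ → ℝ} (hh : Function.Periodic h (2 * Real.pi))
    (x : ℝ) : ∫ u in (-Real.pi)..Real.pi, h (x - u) = ∫ u in (-Real.pi)..Real.pi, h u := by
  rw [intervalIntegral.integral_comp_sub_left]
  have := hh.intervalIntegral_add_eq (x - Real.pi) (-Real.pi)
  convert this using 2 <;> ring

theorem rectIntegral_comp_sub_left_of_periodic {h : ℝ × ℝ → ℝ}
    (h1 : ∀ x y, h (x + 2 * Real.pi, y) = h (x, y)) (h2 : ∀ x y, h (x, y + 2 * Real.pi) = h (x, y))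
    (z : ℝ × ℝ) :
    rectIntegral (-Real.pi) Real.pi (-Real.pi) Real.pi (fun w => h (z - w)) =
      rectIntegral (-Real.pi) Real.pi (-Real.pi) Real.pi h := by
  have e : ∀ y, ∫ x in (-Real.pi)..Real.pi, h (z - (x, y)) =
      ∫ x in (-Real.pi)..Real.pi, h (x, z.2 - y) := fun y =>
    integral_comp_sub_left_of_periodic (h := fun x => h (x, z.2 - y)) (fun x => h1 x _) z.1
  unfold rectIntegral
  simp only [e]
  exact integral_comp_sub_left_of_periodic
    (h := fun y => ∫ x in (-Real.pi)..Real.pi, h (x, y)) (fun y => by simp only [h2]) z.2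

theorem fourierCoef_eq (p q : ℝ → ℝ) (g : ℝ × ℝ → ℝ) (j k : ℕ) :
    rectIntegral (-Real.pi) Real.pi (-Real.pi) Real.pi (fun z => g z * p (j * z.1) * q (k * z.2)) =
      Real.pi ^ 2 * fourierCoef p q g j k := by
  rw [fourierCoef, rectIntegral, ← mul_assoc, mul_one_div_cancel (by positivity), one_mul]

theorem rectIntegral_cos_mul_cos {g : ℝ × ℝ → ℝ} (hg : Continuous g) (x y : ℝ) (j k : ℕ) :
    rectIntegral (-Real.pi) Real.pi (-Real.pi) Real.pi
        (fun t => Real.cos (j * (x - t.1)) * Real.cos (k * (y - t.2)) * g t) =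
      Real.pi ^ 2 * (fourierCoef Real.cos Real.cos g j k * Real.cos (j * x) * Real.cos (k * y)
        + fourierCoef Real.cos Real.sin g j k * Real.cos (j * x) * Real.sin (k * y)
        + fourierCoef Real.sin Real.cos g j k * Real.sin (j * x) * Real.cos (k * y)
        + fourierCoef Real.sin Real.sin g j k * Real.sin (j * x) * Real.sin (k * y)) := by
  have hpt : (fun t : ℝ × ℝ => Real.cos (j * (x - t.1)) * Real.cos (k * (y - t.2)) * g t) =
      fun t => Real.cos (j * x) * Real.cos (k * y) * (g t * Real.cos (j * t.1) * Real.cos (k * t.2))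
        + Real.cos (j * x) * Real.sin (k * y) * (g t * Real.cos (j * t.1) * Real.sin (k * t.2))
        + Real.sin (j * x) * Real.cos (k * y) * (g t * Real.sin (j * t.1) * Real.cos (k * t.2))
        + Real.sin (j * x) * Real.sin (k * y) *
          (g t * Real.sin (j * t.1) * Real.sin (k * t.2)) := by
    ext t
    rw [mul_sub, mul_sub, Real.cos_sub, Real.cos_sub]
    ring
  rw [hpt, rectIntegral_add (by fun_prop) (by fun_prop), rectIntegral_add (by fun_prop)
    (by fun_prop), rectIntegral_add (by fun_prop) (by fun_prop)]
  simp only [rectIntegral_const_mul, fourierCoef_eq]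
  ring

/-- The factors `1/4`, `1/2`, `1` in the series are `cosWeight j * cosWeight k / 4`, and the sine
terms of index `0` vanish, so one formula covers all four cases. -/
theorem fourierTerm_eq {g : ℝ × ℝ → ℝ} (hg : Continuous g) (x y : ℝ) (j k : ℕ) :
    fourierTerm g x y j k = 1 / (4 * Real.pi ^ 2) * (cosWeight j * cosWeight k *
      rectIntegral (-Real.pi) Real.pi (-Real.pi) Real.pi
        (fun t => Real.cos (j * (x - t.1)) * Real.cos (k * (y - t.2)) * g t)) := by
  rw [rectIntegral_cos_mul_cos hg]
  have := Real.pi_ne_zero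
  rcases j with _ | j <;> rcases k with _ | k <;> simp [fourierTerm, cosWeight] <;> field_simp <;>
    ring

/-- The Abel means of the double Fourier series of a continuous periodic function are its
convolution with the product of Poisson kernels. -/
theorem hasSum_fourierTerm {g : ℝ × ℝ → ℝ} (hg : Continuous g)
    (h1 : ∀ x y, g (x + 2 * Real.pi, y) = g (x, y)) (h2 : ∀ x y, g (x, y + 2 * Real.pi) = g (x, y))
    {r s : ℝ} (hr : r ∈ Ico (0 : ℝ) 1) (hs : s ∈ Ico (0 : ℝ) 1) (z : ℝ × ℝ) :
    HasSum (fun i : ℕ × ℕ => fourierTerm g z.1 z.2 i.1 i.2 * r ^ i.1 * s ^ i.2)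
      (1 / (4 * Real.pi ^ 2) * rectIntegral (-Real.pi) Real.pi (-Real.pi) Real.pi
        (fun w => poissonKernel r w.1 * poissonKernel s w.2 * g (z - w))) := by
  -- Periodicity moves the translation from `g` to the kernels, where the cosine series can be
  -- expanded.
  have hshift := rectIntegral_comp_sub_left_of_periodic
    (h := fun t => poissonKernel r (z.1 - t.1) * poissonKernel s (z.2 - t.2) * g t)
    (fun x y => by simp only [h1, ← sub_sub, poissonKernel_sub_two_pi])
    (fun x y => by simp only [h2, ← sub_sub, poissonKernel_sub_two_pi]) z
  simp only [Prod.fst_sub, Prod.snd_sub, sub_sub_cancel] at hshift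
  rw [hshift]
  have hgr := summable_geometric_of_lt_one hr.1 hr.2
  have hgs := summable_geometric_of_lt_one hs.1 hs.2
  have hsum2 : Summable fun i : ℕ × ℕ => (2 * r ^ i.1) * (2 * s ^ i.2) :=
    (hgr.mul_left 2).mul_of_nonneg (hgs.mul_left 2)
      (fun j => mul_nonneg zero_le_two (pow_nonneg hr.1 j))
      (fun j => mul_nonneg zero_le_two (pow_nonneg hs.1 j))
  have hbound : ∀ (i : ℕ × ℕ) (t t' : ℝ),
      |(cosWeight i.1 * r ^ i.1 * Real.cos t) * (cosWeight i.2 * s ^ i.2 * Real.cos t')| ≤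
        (2 * r ^ i.1) * (2 * s ^ i.2) := fun i t t' => by
    rw [abs_mul]
    exact mul_le_mul (abs_cosWeight_term_le hr.1 _ _) (abs_cosWeight_term_le hs.1 _ _)
      (abs_nonneg _) (mul_nonneg zero_le_two (pow_nonneg hr.1 _))
  have hmain := hasSum_rectIntegral (a := -Real.pi) (b := Real.pi) (c := -Real.pi) (d := Real.pi)
    (G := fun (i : ℕ × ℕ) t => (cosWeight i.1 * r ^ i.1 * Real.cos (i.1 * (z.1 - t.1))) *
      (cosWeight i.2 * s ^ i.2 * Real.cos (i.2 * (z.2 - t.2))) * g t)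
    (g := fun t => poissonKernel r (z.1 - t.1) * poissonKernel s (z.2 - t.2) * g t)
    (H := fun t => |g t|) (by linarith [Real.pi_pos]) (by fun_prop) (fun i => by fun_prop) hsum2
    (fun i => mul_nonneg (mul_nonneg zero_le_two (pow_nonneg hr.1 _))
      (mul_nonneg zero_le_two (pow_nonneg hs.1 _)))
    (fun _ => abs_nonneg _)
    (fun i t => by
      rw [abs_mul]
      exact mul_le_mul_of_nonneg_right (hbound i _ _) (abs_nonneg _))
    (fun t => ((hasSum_poissonKernel hr _).mul (hasSum_poissonKernel hs _)
      (.of_norm_bounded hsum2 fun i => hbound i _ _)).mul_right _)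
  refine Eq.mpr (congrArg (fun F => HasSum F _) (funext fun i => ?_))
    (hmain.mul_left (1 / (4 * Real.pi ^ 2)))
  rw [fourierTerm_eq hg, mul_assoc _ (r ^ i.1), mul_assoc (1 / (4 * Real.pi ^ 2)),
    mul_right_comm _ _ (r ^ i.1 * s ^ i.2), ← rectIntegral_const_mul]
  congr 2
  ext t
  ring

/-! ### Poisson means of fuzzy valued functions. -/

section poissonMean

variable {r s : ℝ} {F G : ℝ × ℝ → FuzzyNumber}

/-- The mean of `F` against the product of Poisson kernels over `[-π, π]²`. -/
noncomputable def poissonMean (r s : ℝ) (F : ℝ × ℝ → FuzzyNumber) : FuzzyNumber :=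
  (1 / (4 * Real.pi ^ 2)) •
    riemannIntegral (fun w => (poissonKernel r w.1 * poissonKernel s w.2) • F w)
      (-Real.pi) Real.pi (-Real.pi) Real.pi

theorem poissonKernel_mul_nonneg (hr : r ∈ Ico (0 : ℝ) 1) (hs : s ∈ Ico (0 : ℝ) 1) (w : ℝ × ℝ) :
    0 ≤ poissonKernel r w.1 * poissonKernel s w.2 :=
  mul_nonneg (poissonKernel_nonneg hr _) (poissonKernel_nonneg hs _)

theorem continuous_poissonKernel_mul (hr : r ∈ Ico (0 : ℝ) 1) (hs : s ∈ Ico (0 : ℝ) 1) :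
    Continuous fun w : ℝ × ℝ => poissonKernel r w.1 * poissonKernel s w.2 :=
  ((continuous_poissonKernel hr).comp continuous_fst).mul
    ((continuous_poissonKernel hs).comp continuous_snd)

theorem continuous_poissonKernel_smul (hr : r ∈ Ico (0 : ℝ) 1) (hs : s ∈ Ico (0 : ℝ) 1)
    (hF : Continuous F) :
    Continuous fun w : ℝ × ℝ => (poissonKernel r w.1 * poissonKernel s w.2) • F w :=
  continuous_smul_of_nonneg (continuous_poissonKernel_mul hr hs) (poissonKernel_mul_nonneg hr hs) hF

theorem neg_pi_le_pi : -Real.pi ≤ Real.pi := by linarith [Real.pi_pos]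

theorem lower_poissonMean (hr : r ∈ Ico (0 : ℝ) 1) (hs : s ∈ Ico (0 : ℝ) 1) (hF : Continuous F)
    {α : ℝ} (hα : α ∈ Icc (0 : ℝ) 1) :
    (poissonMean r s F).lower α = 1 / (4 * Real.pi ^ 2) *
      rectIntegral (-Real.pi) Real.pi (-Real.pi) Real.pi
        (fun w => poissonKernel r w.1 * poissonKernel s w.2 * (F w).lower α) := by
  rw [poissonMean, lower_smul _ (by positivity) hα.1 hα.2, (lower_upper_riemannIntegral
    (continuous_poissonKernel_smul hr hs hF) neg_pi_le_pi neg_pi_le_pi hα).1]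
  simp only [lower_smul _ (poissonKernel_mul_nonneg hr hs _) hα.1 hα.2]

theorem upper_poissonMean (hr : r ∈ Ico (0 : ℝ) 1) (hs : s ∈ Ico (0 : ℝ) 1) (hF : Continuous F)
    {α : ℝ} (hα : α ∈ Icc (0 : ℝ) 1) :
    (poissonMean r s F).upper α = 1 / (4 * Real.pi ^ 2) *
      rectIntegral (-Real.pi) Real.pi (-Real.pi) Real.pi
        (fun w => poissonKernel r w.1 * poissonKernel s w.2 * (F w).upper α) := by
  rw [poissonMean, upper_smul _ (by positivity) hα.1 hα.2, (lower_upper_riemannIntegral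
    (continuous_poissonKernel_smul hr hs hF) neg_pi_le_pi neg_pi_le_pi hα).2]
  simp only [upper_smul _ (poissonKernel_mul_nonneg hr hs _) hα.1 hα.2]

/-- Endpoints of the mean are integrals against a nonnegative kernel, so the pointwise `D`-distance
bounds every endpoint difference with no dependence on `α`. -/
theorem dist_poissonMean_le (hr : r ∈ Ico (0 : ℝ) 1) (hs : s ∈ Ico (0 : ℝ) 1) (hF : Continuous F)
    (hG : Continuous G) : dist (poissonMean r s F) (poissonMean r s G) ≤ 1 / (4 * Real.pi ^ 2) *
      rectIntegral (-Real.pi) Real.pi (-Real.pi) Real.pi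
        (fun w => poissonKernel r w.1 * poissonKernel s w.2 * dist (F w) (G w)) := by
  have hK := continuous_poissonKernel_mul hr hs
  have key : ∀ p q : ℝ × ℝ → ℝ, Continuous p → Continuous q →
      (∀ w, |p w - q w| ≤ dist (F w) (G w)) →
      |1 / (4 * Real.pi ^ 2) * rectIntegral (-Real.pi) Real.pi (-Real.pi) Real.pi
          (fun w => poissonKernel r w.1 * poissonKernel s w.2 * p w) -
        1 / (4 * Real.pi ^ 2) * rectIntegral (-Real.pi) Real.pi (-Real.pi) Real.pi
          (fun w => poissonKernel r w.1 * poissonKernel s w.2 * q w)| ≤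
      1 / (4 * Real.pi ^ 2) * rectIntegral (-Real.pi) Real.pi (-Real.pi) Real.pi
        (fun w => poissonKernel r w.1 * poissonKernel s w.2 * dist (F w) (G w)) := by
    intro p q hp hq hpq
    rw [← mul_sub, abs_mul, abs_of_nonneg (by positivity : 0 ≤ 1 / (4 * Real.pi ^ 2))]
    refine mul_le_mul_of_nonneg_left ?_ (by positivity)
    refine abs_rectIntegral_sub_le neg_pi_le_pi neg_pi_le_pi (hK.mul hp) (hK.mul hq)
      (hK.mul (hF.dist hG)) fun w _ => ?_
    rw [← mul_sub, abs_mul, abs_of_nonneg (poissonKernel_mul_nonneg hr hs w)]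
    exact mul_le_mul_of_nonneg_left (hpq w) (poissonKernel_mul_nonneg hr hs w)
  refine dist_le (fun α hα => ?_) fun α hα => ?_
  · rw [lower_poissonMean hr hs hF hα, lower_poissonMean hr hs hG hα]
    exact key _ _ ((continuous_lower hα).comp hF) ((continuous_lower hα).comp hG)
      fun w => abs_lower_sub_le _ _ hα
  · rw [upper_poissonMean hr hs hF hα, upper_poissonMean hr hs hG hα]
    exact key _ _ ((continuous_upper hα).comp hF) ((continuous_upper hα).comp hG)
      fun w => abs_upper_sub_le _ _ hα

theorem poissonMean_const (hr : r ∈ Ico (0 : ℝ) 1) (hs : s ∈ Ico (0 : ℝ) 1) (u : FuzzyNumber) :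
    poissonMean r s (fun _ => u) = u := by
  have key : ∀ t : ℝ, 1 / (4 * Real.pi ^ 2) *
      rectIntegral (-Real.pi) Real.pi (-Real.pi) Real.pi
        (fun w => poissonKernel r w.1 * poissonKernel s w.2 * t) = t := by
    intro t
    simp only [mul_comm _ t]
    rw [rectIntegral_const_mul, rectIntegral_poissonKernel hr hs]
    field_simp
  refine eq_of_dist_eq_zero (le_antisymm (dist_le (fun α hα => ?_) fun α hα => ?_) dist_nonneg)
  · rw [lower_poissonMean hr hs continuous_const hα, key, sub_self, abs_zero]
  · rw [upper_poissonMean hr hs continuous_const hα, key, sub_self, abs_zero]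

end poissonMean

/-! ### Continuity, periodicity, series and convergence of `P_rs f`. -/

section abelPoisson

variable {f : ℝ × ℝ → FuzzyNumber} {r s : ℝ}

/-- Viewing `P_rs f(z)` as the mean of `f(z - ·)` allows comparison with means of other functions:
another translate for continuity, a constant for convergence. -/
theorem abelPoisson_eq_poissonMean (r s : ℝ) (f : ℝ × ℝ → FuzzyNumber) (z : ℝ × ℝ) :
    abelPoisson r s f z = poissonMean r s fun w => f (z - w) := rfl

theorem continuous_abelPoisson (hf : Continuous f) (hr : r ∈ Ico (0 : ℝ) 1)
    (hs : s ∈ Ico (0 : ℝ) 1) : Continuous (abelPoisson r s f) := by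
  refine continuous_iff_continuousAt.2 fun z => tendsto_iff_dist_tendsto_zero.2 ?_
  have hK := continuous_poissonKernel_mul hr hs
  -- A real majorant of the distance to the value at `z`; it is a continuous parametric integral
  -- that vanishes at `z' = z`.
  set h : ℝ × ℝ → ℝ := fun z' => 1 / (4 * Real.pi ^ 2) *
    rectIntegral (-Real.pi) Real.pi (-Real.pi) Real.pi
      (fun w => poissonKernel r w.1 * poissonKernel s w.2 * dist (f (z' - w)) (f (z - w))) with hh
  have hcont : Continuous h := by
    refine continuous_const.mul ?_
    unfold rectIntegral
    refine intervalIntegral.continuous_parametric_intervalIntegral_of_continuous' ?_ _ _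
    refine intervalIntegral.continuous_parametric_intervalIntegral_of_continuous' ?_ _ _
    have h1 : Continuous fun p : ((ℝ × ℝ) × ℝ) × ℝ => ((p.2, p.1.2) : ℝ × ℝ) := by fun_prop
    exact (hK.comp h1).mul ((hf.comp (by fun_prop)).dist (hf.comp (by fun_prop)))
  have h0 : h z = 0 := by simp [hh, rectIntegral]
  refine squeeze_zero (fun _ => dist_nonneg) (fun z' => ?_) (h0 ▸ hcont.tendsto z)
  exact dist_poissonMean_le hr hs (hf.comp (by fun_prop)) (hf.comp (by fun_prop))

theorem abelPoisson_mem_periodicContinuous (hf : f ∈ periodicContinuous) (hr : r ∈ Ico (0 : ℝ) 1)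
    (hs : s ∈ Ico (0 : ℝ) 1) : abelPoisson r s f ∈ periodicContinuous := by
  refine ⟨continuous_abelPoisson hf.1 hr hs, fun x y k => ⟨?_, ?_⟩⟩
  · simp only [abelPoisson_eq_poissonMean]
    congr 1; ext1 ⟨u, v⟩
    rw [Prod.mk_sub_mk, Prod.mk_sub_mk, add_sub_right_comm]
    exact (hf.2 _ _ k).1
  · simp only [abelPoisson_eq_poissonMean]
    congr 1; ext1 ⟨u, v⟩
    rw [Prod.mk_sub_mk, Prod.mk_sub_mk, add_sub_right_comm]
    exact (hf.2 _ _ k).2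

theorem add_two_pi_of_mem_periodicContinuous (hf : f ∈ periodicContinuous) (x y : ℝ) :
    f (x + 2 * Real.pi, y) = f (x, y) ∧ f (x, y + 2 * Real.pi) = f (x, y) := by
  simpa using hf.2 x y 1

theorem hasSum_abelPoisson (hf : f ∈ periodicContinuous) (hr : r ∈ Ico (0 : ℝ) 1)
    (hs : s ∈ Ico (0 : ℝ) 1) (z : ℝ × ℝ) {α : ℝ} (hα : α ∈ Icc (0 : ℝ) 1) :
    HasSum (fun i : ℕ × ℕ =>
        fourierTerm (fun z => (f z).lower α) z.1 z.2 i.1 i.2 * r ^ i.1 * s ^ i.2)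
      ((abelPoisson r s f z).lower α) ∧
    HasSum (fun i : ℕ × ℕ =>
        fourierTerm (fun z => (f z).upper α) z.1 z.2 i.1 i.2 * r ^ i.1 * s ^ i.2)
      ((abelPoisson r s f z).upper α) := by
  have hp := add_two_pi_of_mem_periodicContinuous hf
  have hfz : Continuous fun w => f (z - w) := hf.1.comp (by fun_prop)
  rw [abelPoisson_eq_poissonMean, lower_poissonMean hr hs hfz hα, upper_poissonMean hr hs hfz hα]
  exact ⟨hasSum_fourierTerm ((continuous_lower hα).comp hf.1)
      (fun x y => congrArg (lower · α) (hp x y).1)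
      (fun x y => congrArg (lower · α) (hp x y).2) hr hs z,
    hasSum_fourierTerm ((continuous_upper hα).comp hf.1)
      (fun x y => congrArg (upper · α) (hp x y).1)
      (fun x y => congrArg (upper · α) (hp x y).2) hr hs z⟩

/-- Every point is congruent modulo the periods to a point of `[0, 2π]²`. -/
theorem exists_translate (hf : f ∈ periodicContinuous) (z : ℝ × ℝ) :
    ∃ z' ∈ Icc (0 : ℝ) (2 * Real.pi) ×ˢ Icc (0 : ℝ) (2 * Real.pi), ∀ w, f (z - w) = f (z' - w) := by
  obtain ⟨k, hk, -⟩ := existsUnique_add_zsmul_mem_Ico Real.two_pi_pos z.1 0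
  obtain ⟨l, hl, -⟩ := existsUnique_add_zsmul_mem_Ico Real.two_pi_pos z.2 0
  rw [zero_add, zsmul_eq_mul] at hk hl
  refine ⟨(z.1 + k * (2 * Real.pi), z.2 + l * (2 * Real.pi)),
    ⟨Ico_subset_Icc_self hk, Ico_subset_Icc_self hl⟩, fun w => ?_⟩
  have h1 := (hf.2 (z.1 - w.1) (z.2 - w.2 + 2 * l * Real.pi) k).1
  have h2 := (hf.2 (z.1 - w.1) (z.2 - w.2) l).2
  rw [← h1] at h2
  refine h2.symm.trans (congrArg f (Prod.ext ?_ ?_))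
  · simp only [Prod.fst_sub]; ring
  · simp only [Prod.snd_sub]; ring

/-- For small `w` uniform continuity gives `ε`; otherwise some `1 - cos wᵢ` is bounded below, and a
large multiple of it exceeds the diameter of the range of `f`. The constant `B` does not depend on
`z`. -/
theorem exists_dist_le_add_mul_one_sub_cos (hf : f ∈ periodicContinuous) {ε : ℝ} (hε : 0 < ε) :
    ∃ B, ∀ z, ∀ w ∈ Icc (-Real.pi) Real.pi ×ˢ Icc (-Real.pi) Real.pi,
      dist (f (z - w)) (f z) ≤ ε + B * ((1 - Real.cos w.1) + (1 - Real.cos w.2)) := by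
  have hpi := Real.pi_pos
  -- Large enough to contain both coordinates of `z'` and of `z' - w`, for `z'` in `[0, 2π]²` and
  -- `w` in `[-π, π]²`.
  set I := Icc (-Real.pi) (3 * Real.pi) with hI
  have hK : IsCompact (I ×ˢ I) := isCompact_Icc.prod isCompact_Icc
  obtain ⟨δ, hδ, hδf⟩ := Metric.uniformContinuousOn_iff.1
    (hK.uniformContinuousOn_of_continuous hf.1.continuousOn) ε hε
  obtain ⟨M, hM⟩ := Metric.isBounded_iff.1 (hK.image hf.1).isBounded
  -- Capping at `π` keeps `η` where cosine is decreasing, so `η ≤ |t| ≤ π` forces `1 - cos t ≥ 1 -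
  -- cos η > 0`.
  set η := min δ Real.pi with hη
  have hη0 : 0 < η := lt_min hδ hpi
  have hcos : 0 < 1 - Real.cos η := by
    have := Real.cos_lt_cos_of_nonneg_of_le_pi le_rfl (min_le_right _ _) hη0
    rw [Real.cos_zero] at this
    linarith
  have hM0 : 0 ≤ M := dist_nonneg.trans (hM (mem_image_of_mem f (⟨⟨by linarith, by linarith⟩,
    ⟨by linarith, by linarith⟩⟩ : ((0 : ℝ), (0 : ℝ)) ∈ I ×ˢ I)) (mem_image_of_mem f
    (⟨⟨by linarith, by linarith⟩, ⟨by linarith, by linarith⟩⟩ : ((0 : ℝ), (0 : ℝ)) ∈ I ×ˢ I)))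
  have hB : 0 ≤ M / (1 - Real.cos η) := by positivity
  have hfar : ∀ t ∈ Icc (-Real.pi) Real.pi, η ≤ |t| →
      M ≤ M / (1 - Real.cos η) * (1 - Real.cos t) := by
    intro t ht hηt
    have hc : Real.cos t ≤ Real.cos η := by
      rw [← Real.cos_abs t]
      exact Real.cos_le_cos_of_nonneg_of_le_pi hη0.le (abs_le.2 ht) hηt
    calc M = M / (1 - Real.cos η) * (1 - Real.cos η) := (div_mul_cancel₀ _ hcos.ne').symm
      _ ≤ _ := mul_le_mul_of_nonneg_left (by linarith) hB
  refine ⟨M / (1 - Real.cos η), fun z w hw => ?_⟩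
  obtain ⟨z', hz', hzz'⟩ := exists_translate hf z
  have h0 := hzz' 0
  rw [sub_zero, sub_zero] at h0
  rw [hzz' w, h0]
  obtain ⟨⟨hz1, hz2⟩, hz3, hz4⟩ := hz'
  obtain ⟨⟨hw1, hw2⟩, hw3, hw4⟩ := id hw
  have hmz : z' ∈ I ×ˢ I := ⟨⟨by linarith, by linarith⟩, ⟨by linarith, by linarith⟩⟩
  have hmw : z' - w ∈ I ×ˢ I := ⟨⟨by rw [Prod.fst_sub]; linarith, by rw [Prod.fst_sub]; linarith⟩,
    ⟨by rw [Prod.snd_sub]; linarith, by rw [Prod.snd_sub]; linarith⟩⟩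
  have hc1 := mul_nonneg hB (sub_nonneg.2 (Real.cos_le_one w.1))
  have hc2 := mul_nonneg hB (sub_nonneg.2 (Real.cos_le_one w.2))
  have hdM := hM (mem_image_of_mem f hmw) (mem_image_of_mem f hmz)
  rw [mul_add]
  rcases le_or_gt η |w.1| with h | h
  · linarith [hfar _ hw.1 h]
  rcases le_or_gt η |w.2| with h' | h'
  · linarith [hfar _ hw.2 h']
  have hd : dist (z' - w) z' < δ := by
    rw [dist_eq_norm, sub_sub_cancel_left, norm_neg, Prod.norm_def]
    exact max_lt (h.trans_le (min_le_left _ _)) (h'.trans_le (min_le_left _ _))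
  linarith [hδf _ hmw _ hmz hd]

theorem tendstoUniformly_abelPoisson (hf : f ∈ periodicContinuous) :
    TendstoUniformly (fun p : ℝ × ℝ => abelPoisson p.1 p.2 f) f
      (𝓝[<] (1 : ℝ) ×ˢ 𝓝[<] (1 : ℝ)) := by
  refine Metric.tendstoUniformly_iff.2 fun ε hε => ?_
  obtain ⟨B, hB⟩ := exists_dist_le_add_mul_one_sub_cos hf (half_pos hε)
  have hI : ∀ᶠ r in 𝓝[<] (1 : ℝ), r ∈ Ioo (0 : ℝ) 1 := Ioo_mem_nhdsLT one_pos
  have hlim : Tendsto (fun p : ℝ × ℝ => ε / 2 + B * ((1 - p.1) + (1 - p.2)))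
      (𝓝[<] (1 : ℝ) ×ˢ 𝓝[<] (1 : ℝ)) (𝓝 (ε / 2)) := by
    have hc : Continuous fun p : ℝ × ℝ => ε / 2 + B * ((1 - p.1) + (1 - p.2)) := by fun_prop
    have := hc.tendsto (1, 1)
    simp only [sub_self, add_zero, mul_zero, nhds_prod_eq] at this
    exact this.mono_left (Filter.prod_mono nhdsWithin_le_nhds nhdsWithin_le_nhds)
  filter_upwards [hI.prod_mk hI, hlim.eventually_lt_const (half_lt_self hε)] with p hp hlt z
  have hr : p.1 ∈ Ico (0 : ℝ) 1 := Ioo_subset_Ico_self hp.1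
  have hs : p.2 ∈ Ico (0 : ℝ) 1 := Ioo_subset_Ico_self hp.2
  have hK := continuous_poissonKernel_mul hr hs
  have hfz : Continuous fun w => f (z - w) := hf.1.comp (by fun_prop)
  -- The value `f z` is its own Poisson mean, as a constant function, so both points are means of
  -- the same kernel.
  have h := dist_poissonMean_le hr hs hfz (continuous_const (y := f z))
  rw [poissonMean_const hr hs] at h
  rw [dist_comm]
  refine (h.trans ?_).trans_lt hlt
  have hle := rectIntegral_mono_on neg_pi_le_pi neg_pi_le_pi
    (hK.mul (hfz.dist (continuous_const (y := f z))))
    (h := fun w => poissonKernel p.1 w.1 * poissonKernel p.2 w.2 *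
      (ε / 2 + B * ((1 - Real.cos w.1) + (1 - Real.cos w.2)))) (hK.mul (by fun_prop))
    fun w hw => mul_le_mul_of_nonneg_left (hB z w hw) (poissonKernel_mul_nonneg hr hs w)
  rw [rectIntegral_poissonKernel_mul_cos hp.1 hp.2] at hle
  rw [one_div, inv_mul_le_iff₀ (by positivity)]
  exact hle

end abelPoisson

end FuzzyNumber

/-! ### The theorem. -/

theorem mainTheorem6 (f : ℝ × ℝ → FuzzyNumber) (hf : f ∈ FuzzyNumber.periodicContinuous) :
    (∀ r ∈ Set.Ico (0 : ℝ) 1, ∀ s ∈ Set.Ico (0 : ℝ) 1,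
      (∀ x y : ℝ, FuzzyNumber.RiemannIntegrable (FuzzyNumber.abelPoissonIntegrand r s f x y)
        (-Real.pi) Real.pi (-Real.pi) Real.pi) ∧
      FuzzyNumber.abelPoisson r s f ∈ FuzzyNumber.periodicContinuous ∧
      ∀ x y : ℝ, ∀ α ∈ Set.Icc (0 : ℝ) 1,
        HasSum (fun i : ℕ × ℕ =>
            FuzzyNumber.fourierTerm (fun z => (f z).lower α) x y i.1 i.2 * r ^ i.1 * s ^ i.2)
          ((FuzzyNumber.abelPoisson r s f (x, y)).lower α) ∧
        HasSum (fun i : ℕ × ℕ =>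
            FuzzyNumber.fourierTerm (fun z => (f z).upper α) x y i.1 i.2 * r ^ i.1 * s ^ i.2)
          ((FuzzyNumber.abelPoisson r s f (x, y)).upper α)) ∧
    TendstoUniformly (fun (p : ℝ × ℝ) => FuzzyNumber.abelPoisson p.1 p.2 f) f
      (𝓝[<] (1 : ℝ) ×ˢ 𝓝[<] (1 : ℝ)) := by
  have hpi := FuzzyNumber.neg_pi_le_pi
  refine ⟨fun r hr s hs => ⟨fun x y => ?_, FuzzyNumber.abelPoisson_mem_periodicContinuous hf hr hs,
    fun x y α hα => FuzzyNumber.hasSum_abelPoisson hf hr hs (x, y) hα⟩,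
    FuzzyNumber.tendstoUniformly_abelPoisson hf⟩
  exact FuzzyNumber.riemannIntegrable_of_continuous (FuzzyNumber.continuous_poissonKernel_smul hr hs
    (F := fun w => f (x - w.1, y - w.2)) (hf.1.comp (by fun_prop))) hpi hpi
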